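/- Let $\mathbb N=\{1,2,3,\dots\}$, let $\mathbb N^2$ carry the coordinatewise multiplication, and let $\mathbb H=\{z\in\mathbb C:\operatorname{Re}z\ge 0\}$. A *weight* on $\mathbb N^2$ is a function $\omega:\mathbb N^2\to[1,\infty)$ with $\omega(m_1m_2,n_1n_2)\le\omega(m_1,n_1)\,\omega(m_2,n_2)$ for all $(m_1,n_1),(m_2,n_2)\in\mathbb N^2$. It is *admissible* if $\lim_{n\to\infty}\omega(l^n,k^n)^{1/n}=1$ for all $(l,k)\in\mathbb N^2$. It is *almost monotone* if it is admissible or there is a constant $K>0$ such that $\omega(m_1,n_1)\le K\,\omega(m_2,n_2)$ whenever $m_1\mid m_2$ and $n_1\mid n_2$. A function $\widetilde a:\mathbb H^2\to\mathbb C$ has an *$\omega$-absolutely convergent Dirichlet series* if there are coefficients $a(m,n)\in\mathbb C$ with $\sum_{(m,n)\in\mathbb N^2}|a(m,n)|\,\omega(m,n)<\infty$ and $$\widetilde a(s_1,s_2)=\sum_{(m,n)\in\mathbb N^2}a(m,n)\,m^{-s_1}n^{-s_2}\qquad\text{for all }(s_1,s_2)\in\mathbb H^2 .$$ **Theorem.**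 Let $\omega$ be an almost monotone weight on $\mathbb N^2$, and let $\widetilde a:\mathbb H^2\to\mathbb C$ have an $\omega$-absolutely convergent Dirichlet series. (I) If $\widetilde a$ is bounded away from zero, i.e. there is $k>0$ with $|\widetilde a|\ge k$ on $\mathbb H^2$, then there is an almost monotone weight $\nu$ on $\mathbb N^2$ such that 1. $\nu$ is constant if and only if $\omega$ is constant; 2. $\nu$ is admissible if and only if $\omega$ is admissible; 3. $1\le\nu\le\omega$; 4. $1/\widetilde a$ has a $\nu$-absolutely convergent Dirichlet series. (II) If $\varphi$ is holomorphic on an open neighbourhood of the closure of the range of $\widetilde a$, then there is an almost monotone weight $\xi$ on $\mathbb N^2$ such that 1. $\xi$ is constant if and only if $\omega$ is constant; 2. $\xi$ is admissible if and only if $\omega$ is admissible; 3. $1\le\xi\le\omega$; 4. $\varphi\circ\widetilde a$ has a $\xi$-absolutely convergent Dirichlet series. -/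

import Mathlib

open Filter Topology

/-- The closed right half plane. -/
def closedRightHalfPlane : Set ℂ := {z | 0 ≤ z.re}

/-- A weight on the semigroup of pairs of positive integers under pointwise multiplication:
a submultiplicative function with values in `[1, ∞)`. -/
structure IsWeight (ω : ℕ+ × ℕ+ → ℝ) : Prop where
  one_le : ∀ x, 1 ≤ ω x
  mul_le : ∀ x y, ω (x * y) ≤ ω x * ω y

/-- Admissibility: `ω (l ^ n, k ^ n) ^ (1 / n) → 1` for all `(l, k)`. -/
def IsAdmissible (ω : ℕ+ × ℕ+ → ℝ) : Prop :=
  ∀ l k : ℕ+, Tendsto (fun n : ℕ => ω (l ^ n, k ^ n) ^ (1 / (n : ℝ))) atTop (𝓝 1)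

/-- Almost monotone: admissible, or increasing for divisibility in both coordinates up to a
constant factor. -/
def IsAlmostMonotone (ω : ℕ+ × ℕ+ → ℝ) : Prop :=
  IsAdmissible ω ∨
    ∃ K : ℝ, 0 < K ∧ ∀ m₁ n₁ m₂ n₂ : ℕ+, m₁ ∣ m₂ → n₁ ∣ n₂ → ω (m₁, n₁) ≤ K * ω (m₂, n₂)

/-- The function is constant. -/
def IsConstantWeight (ω : ℕ+ × ℕ+ → ℝ) : Prop :=
  ∃ c : ℝ, ∀ x, ω x = c

/-- `f` is the sum of a Dirichlet series in two variables on the square of the closed right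
half plane, with coefficients that are absolutely summable against `ω`. -/
def HasAbsConvDirichletSeries (ω : ℕ+ × ℕ+ → ℝ)
    (f : closedRightHalfPlane × closedRightHalfPlane → ℂ) : Prop :=
  ∃ a : ℕ+ × ℕ+ → ℂ,
    Summable (fun x => ‖a x‖ * ω x) ∧
    ∀ s : closedRightHalfPlane × closedRightHalfPlane,
      HasSum (fun x : ℕ+ × ℕ+ =>
        a x * ((x.1 : ℕ) : ℂ) ^ (-(s.1 : ℂ)) * ((x.2 : ℕ) : ℂ) ^ (-(s.2 : ℂ))) (f s)

/-- `|f|` has a positive lower bound. -/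
def IsBoundedAwayFromZero (f : closedRightHalfPlane × closedRightHalfPlane → ℂ) : Prop :=
  ∃ k : ℝ, 0 < k ∧ ∀ s, k ≤ ‖f s‖

/-! The theorem is a Wiener–Lévy theorem. In the commutative Banach algebra of `ω`-summable
coefficients, φ can be applied to an element whose spectrum lies in the domain of φ. The spectrum
consists of the sums ∑ a(x)χ(x), with χ a multiplicative function on ℕ² dominated by the weight, so
everything rests on locating these sums.

If |χ| ≤ 1, the sum lies in the closure of the range of the series (`tsum_mul_mem_closure_range`).
By Bohr's lift, a one-variable χ is the point of the polydisc formed by its values at the primes.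
Kronecker's theorem handles the torus points scaled by p^(-σ). A general point is θ_p u^(x_p), and
the exponents x_p are deformed into log p. A value missed both on the torus and at the origin cannot
appear or disappear along the way (`value_parameters_mem_nhds`). The two variables are then treated
one after the other.

If `ω` is admissible, every χ dominated by `ω` satisfies |χ| ≤ 1, and `ω` itself serves as the new
weight. Otherwise `ω` is monotone up to a constant and grows exponentially along the powers of some
prime in one coordinate. It then dominates ρ^v, where v is the exponent of that prime and ρ > 1
(`exists_exponent_of_not_isAdmissible`). The new weight is r^v with r > 1 close to 1: a character
dominated by it is a small perturbation of one bounded by 1, so the sums stay in a neighbourhood of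
the closed range. Part (I) is the case φ(z) = 1/z. -/

/-! ### The Cauchy–Pompeiu formula. -/

section CauchyPompeiu

open MeasureTheory Set

/-- The Wirtinger derivative with respect to the conjugate variable of a real differentiable function. -/
noncomputable def dbar (g : ℂ → ℂ) (z : ℂ) : ℂ :=
  (fderiv ℝ g z 1 + Complex.I * fderiv ℝ g z Complex.I) / 2

theorem continuous_dbar {g : ℂ → ℂ} (hg : ContDiff ℝ 1 g) : Continuous (dbar g) := by
  have h : Continuous (fderiv ℝ g) := hg.continuous_fderiv one_ne_zero
  unfold dbar
  fun_prop

theorem dbar_eq_zero_of_eventuallyEq {g φ : ℂ → ℂ} {z : ℂ} (h : g =ᶠ[𝓝 z] φ)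
    (hφ : DifferentiableAt ℂ φ z) : dbar g z = 0 := by
  have h2 : fderiv ℝ φ z Complex.I = Complex.I * fderiv ℝ φ z 1 := by
    rw [hφ.fderiv_restrictScalars ℝ]
    simp only [ContinuousLinearMap.coe_restrictScalars']
    conv_lhs => rw [← mul_one Complex.I, ← smul_eq_mul, map_smul, smul_eq_mul]
  rw [dbar, h.fderiv_eq, h2, ← mul_assoc, Complex.I_mul_I]
  ring

/-- At z = r exp(iθ) the Jacobian r of polar coordinates turns 1/z into exp(-iθ). What remains of
the integrand is a radial derivative of g plus i/r times an angular one, each of which integrates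
explicitly. -/
theorem dbar_mul_polar (g : ℂ → ℂ) (z : ℂ) (θ : ℝ) :
    dbar g z * Complex.exp (-(θ * Complex.I)) =
      (fderiv ℝ g z (Complex.exp (θ * Complex.I)) +
        Complex.I * fderiv ℝ g z (Complex.I * Complex.exp (θ * Complex.I))) / 2 := by
  have hv : ∀ x y : ℝ, fderiv ℝ g z (x + y * Complex.I)
      = x * fderiv ℝ g z 1 + y * fderiv ℝ g z Complex.I := by
    intro x y
    have : (x + y * Complex.I : ℂ) = x • (1 : ℂ) + y • Complex.I := by simp
    rw [this, map_add, map_smul, map_smul]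
    simp
  have e1 : Complex.exp (θ * Complex.I) = (Real.cos θ : ℝ) + (Real.sin θ : ℝ) * Complex.I := by
    rw [Complex.exp_mul_I, Complex.ofReal_cos, Complex.ofReal_sin]
  have e2 : Complex.I * Complex.exp (θ * Complex.I)
      = ((-Real.sin θ : ℝ) : ℂ) + (Real.cos θ : ℝ) * Complex.I := by
    rw [e1]; push_cast; linear_combination (Complex.sin θ) * Complex.I_mul_I
  have e3 : Complex.exp (-(θ * Complex.I)) = (Real.cos θ : ℝ) - (Real.sin θ : ℝ) * Complex.I := by
    rw [← neg_mul, Complex.exp_mul_I, Complex.ofReal_cos, Complex.ofReal_sin]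
    simp [sub_eq_add_neg]
  rw [e2, hv, e1, hv, e3, dbar]
  push_cast
  linear_combination (-(Complex.sin θ) * fderiv ℝ g z Complex.I / 2) * Complex.I_mul_I

theorem hasDerivAt_comp_polar_radius {g : ℂ → ℂ} (hg : ContDiff ℝ 1 g) (r θ : ℝ) :
    HasDerivAt (fun r : ℝ => g (r * Complex.exp (θ * Complex.I)))
      (fderiv ℝ g (r * Complex.exp (θ * Complex.I)) (Complex.exp (θ * Complex.I))) r := by
  have h1 : HasDerivAt (fun r : ℝ => (r : ℂ) * Complex.exp (θ * Complex.I))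
      (Complex.exp (θ * Complex.I)) r := by
    simpa using (Complex.ofRealCLM.hasDerivAt (x := r)).mul_const (Complex.exp (θ * Complex.I))
  exact ((hg.differentiable one_ne_zero _).hasFDerivAt).comp_hasDerivAt r h1

theorem hasDerivAt_comp_polar_angle {g : ℂ → ℂ} (hg : ContDiff ℝ 1 g) (r θ : ℝ) :
    HasDerivAt (fun θ : ℝ => g (r * Complex.exp (θ * Complex.I)))
      (r * fderiv ℝ g (r * Complex.exp (θ * Complex.I))
        (Complex.I * Complex.exp (θ * Complex.I))) θ := by
  have h1 : HasDerivAt (fun θ : ℝ => (r : ℂ) * Complex.exp (θ * Complex.I))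
      (r • (Complex.I * Complex.exp (θ * Complex.I))) θ := by
    have := (((Complex.ofRealCLM.hasDerivAt (x := θ)).mul_const Complex.I).cexp).const_mul (r : ℂ)
    have e : r • (Complex.I * Complex.exp (θ * Complex.I))
        = r * (Complex.exp (θ * Complex.I) * (Complex.ofRealCLM 1 * Complex.I)) := by
      rw [Complex.real_smul, Complex.ofRealCLM_apply, Complex.ofReal_one, one_mul,
        mul_comm Complex.I]
    rw [e]
    exact this
  have := ((hg.differentiable one_ne_zero _).hasFDerivAt).comp_hasDerivAt θ h1
  rwa [map_smul, Complex.real_smul] at this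

/-- The **Cauchy–Pompeiu formula** for compactly supported functions, at the origin. -/
theorem integral_dbar_div_self {g : ℂ → ℂ} (hg : ContDiff ℝ 1 g) (hc : HasCompactSupport g) :
    ∫ z, dbar g z / z = -Real.pi * g 0 := by
  obtain ⟨R, hR0, hR⟩ : ∃ R : ℝ, 0 < R ∧ ∀ z : ℂ, R < ‖z‖ → z ∉ tsupport g := by
    obtain ⟨R, hR⟩ := hc.isBounded.subset_closedBall (0 : ℂ)
    refine ⟨max R 1, by positivity, fun z hz hz' => ?_⟩
    have := hR hz'
    rw [mem_closedBall_zero_iff] at this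
    exact absurd hz (not_lt.2 (this.trans (le_max_left _ _)))
  have hfd0 : ∀ z : ℂ, R < ‖z‖ → fderiv ℝ g z = 0 := fun z hz =>
    image_eq_zero_of_notMem_tsupport fun h => hR z hz (tsupport_fderiv_subset ℝ h)
  have hnorm : ∀ r θ : ℝ, 0 < r → ‖(r : ℂ) * Complex.exp (θ * Complex.I)‖ = r := by
    intro r θ hr
    rw [norm_mul, Complex.norm_exp_ofReal_mul_I, mul_one, Complex.norm_real,
      Real.norm_of_nonneg hr.le]
  have hfdc : Continuous (fderiv ℝ g) := hg.continuous_fderiv one_ne_zero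
  set A : ℝ × ℝ → ℂ := fun p =>
    fderiv ℝ g (p.1 * Complex.exp (p.2 * Complex.I)) (Complex.exp (p.2 * Complex.I)) with hA
  set B : ℝ × ℝ → ℂ := fun p =>
    fderiv ℝ g (p.1 * Complex.exp (p.2 * Complex.I))
      (Complex.I * Complex.exp (p.2 * Complex.I)) with hB
  have hAc : Continuous A := by fun_prop
  have hBc : Continuous B := by fun_prop
  have hinteg : ∀ F : ℝ × ℝ → ℂ, Continuous F → (∀ p : ℝ × ℝ, R < p.1 → F p = 0) →
      IntegrableOn F (Ioi 0 ×ˢ Ioo (-Real.pi) Real.pi) (volume.prod volume) := by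
    intro F hF h0
    have hK : IntegrableOn F (Icc 0 R ×ˢ Icc (-Real.pi) Real.pi) (volume.prod volume) :=
      hF.continuousOn.integrableOn_compact (isCompact_Icc.prod isCompact_Icc)
    refine hK.of_forall_sdiff_eq_zero (measurableSet_Ioi.prod measurableSet_Ioo) ?_
    rintro ⟨r, θ⟩ ⟨⟨h1, h2⟩, h3⟩
    apply h0
    by_contra h
    exact h3 ⟨⟨le_of_lt h1, not_lt.1 h⟩, ⟨h2.1.le, h2.2.le⟩⟩
  have hAi := hinteg A hAc fun p hp => by
    rw [hA]; dsimp only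
    rw [hfd0 _ (by rwa [hnorm _ _ (hR0.trans hp)])]; rfl
  have hBi := hinteg B hBc fun p hp => by
    rw [hB]; dsimp only
    rw [hfd0 _ (by rwa [hnorm _ _ (hR0.trans hp)])]; rfl
  have hAI : ∫ p in Ioi 0 ×ˢ Ioo (-Real.pi) Real.pi, A p ∂(volume.prod volume)
      = -(2 * Real.pi) * g 0 := by
    -- `A` is the radial derivative of g, so integrating in r first gives -g(0) on every ray.
    rw [← setIntegral_prod_swap, setIntegral_prod (fun z : ℝ × ℝ => A z.swap) hAi.swap]
    have : ∀ θ : ℝ, ∫ r in Ioi (0 : ℝ), A (r, θ) = - g 0 := by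
      intro θ
      have hcont : Continuous fun r : ℝ => A (r, θ) := by fun_prop
      have hio : IntegrableOn (fun r : ℝ => A (r, θ)) (Ioi 0) := by
        refine (hcont.continuousOn.integrableOn_compact
          (isCompact_Icc (a := 0) (b := R))).of_forall_sdiff_eq_zero measurableSet_Ioi ?_
        rintro r ⟨h1, h2⟩
        have hr : R < r := by
          by_contra h; exact h2 ⟨le_of_lt h1, not_lt.1 h⟩
        simp only [hA]
        rw [hfd0 _ (by rwa [hnorm _ _ (hR0.trans hr)])]; rfl
      have h := integral_Ioi_of_hasDerivAt_of_tendsto (m := 0)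
        (hasDerivAt_comp_polar_radius hg 0 θ).continuousAt.continuousWithinAt
        (fun r _ => hasDerivAt_comp_polar_radius hg r θ) hio ?_
      · simpa using h
      · refine tendsto_const_nhds.congr' ?_
        filter_upwards [eventually_gt_atTop R] with r hr
        exact (image_eq_zero_of_notMem_tsupport
          (hR _ (by rwa [hnorm _ _ (hR0.trans hr)]))).symm
    simp only [Prod.swap_prod_mk, this]
    rw [setIntegral_const, Real.volume_real_Ioo_of_le (by linarith [Real.pi_pos]),
      Complex.real_smul]
    push_cast
    ring
  have hBI : ∫ p in Ioi 0 ×ˢ Ioo (-Real.pi) Real.pi, B p ∂(volume.prod volume) = 0 := by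
    rw [setIntegral_prod _ hBi]
    rw [setIntegral_congr_fun measurableSet_Ioi (g := fun _ => (0 : ℂ)), integral_zero]
    intro r hr
    have hr : (0 : ℝ) < r := hr
    dsimp only
    rw [← integral_Ioc_eq_integral_Ioo, ← intervalIntegral.integral_of_le
      (by linarith [Real.pi_pos] : -Real.pi ≤ Real.pi)]
    -- r times `B` is the angular derivative of g, whose integral over a full circle vanishes.
    have hcont : Continuous fun θ : ℝ => (r : ℂ) * B (r, θ) := by fun_prop
    have h := intervalIntegral.integral_eq_sub_of_hasDerivAt (a := -Real.pi) (b := Real.pi)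
      (fun θ _ => hasDerivAt_comp_polar_angle hg r θ) (hcont.intervalIntegrable _ _)
    rw [intervalIntegral.integral_const_mul] at h
    have h3 : Complex.exp (((-Real.pi : ℝ) : ℂ) * Complex.I)
        = Complex.exp ((Real.pi : ℂ) * Complex.I) := by
      rw [Complex.ofReal_neg, neg_mul, Complex.exp_neg, Complex.exp_pi_mul_I]; norm_num
    rw [h3, sub_self] at h
    exact (mul_eq_zero.1 h).resolve_left (by exact_mod_cast hr.ne')
  rw [← Complex.integral_comp_polarCoord_symm]
  have hpt : polarCoord.target = Ioi (0 : ℝ) ×ˢ Ioo (-Real.pi) Real.pi := rfl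
  rw [hpt, setIntegral_congr_fun (measurableSet_Ioi.prod measurableSet_Ioo)
    (g := fun p => (1 / 2 : ℂ) * A p + (Complex.I / 2) * B p), Measure.volume_eq_prod,
    integral_add (hAi.const_mul _) (hBi.const_mul _), integral_const_mul, integral_const_mul,
    hAI, hBI]
  · ring
  · rintro ⟨r, θ⟩ ⟨hr, -⟩
    have hr : (0 : ℝ) < r := hr
    have hr' : (r : ℂ) ≠ 0 := by exact_mod_cast hr.ne'
    have e : Complex.polarCoord.symm (r, θ) = r * Complex.exp (θ * Complex.I) := by
      rw [Complex.polarCoord_symm_apply, Complex.exp_mul_I, Complex.ofReal_cos, Complex.ofReal_sin]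
    have hdm := dbar_mul_polar g (r * Complex.exp (θ * Complex.I)) θ
    dsimp only
    rw [e, hA, hB]
    dsimp only
    rw [Complex.real_smul]
    have : (r : ℂ) * (dbar g (r * Complex.exp (θ * Complex.I)) / (r * Complex.exp (θ * Complex.I)))
        = dbar g (r * Complex.exp (θ * Complex.I)) * Complex.exp (-(θ * Complex.I)) := by
      rw [Complex.exp_neg]
      field_simp
    rw [this, hdm]
    ring

/-- The **Cauchy–Pompeiu formula** for compactly supported functions. -/
theorem integral_dbar_div_sub {g : ℂ → ℂ} (hg : ContDiff ℝ 1 g) (hc : HasCompactSupport g)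
    (w : ℂ) : ∫ z, dbar g z / (z - w) = -Real.pi * g w := by
  have h := integral_dbar_div_self (g := fun z => g (z + w))
    (hg.comp (contDiff_id.add contDiff_const))
    (hc.comp_homeomorph (Homeomorph.addRight w))
  rw [zero_add] at h
  rw [← h, ← integral_add_right_eq_self _ w]
  refine integral_congr_ae (Eventually.of_forall fun z => ?_)
  simp only [dbar, add_sub_cancel_right, fderiv_comp_add_right]

end CauchyPompeiu

/-! ### Holomorphic functional calculus in a commutative Banach algebra. -/

section FunctionalCalculus

open MeasureTheory Set

/-- Nothing is known about φ outside U, but there the product vanishes on a whole neighbourhood, the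
complement of L. -/
theorem contDiff_smul_of_differentiableOn {U L : Set ℂ} (hU : IsOpen U) (hL : IsClosed L)
    (hLU : L ⊆ U) {ψ : ℂ → ℝ} (hψ : ContDiff ℝ 1 ψ) (h0 : ∀ z ∉ L, ψ z = 0) {φ : ℂ → ℂ}
    (hφ : DifferentiableOn ℂ φ U) : ContDiff ℝ 1 fun z => ψ z • φ z := by
  rw [contDiff_iff_contDiffAt]
  intro z
  by_cases hz : z ∈ U
  · exact hψ.contDiffAt.smul
      (((hφ.contDiffOn hU).contDiffAt (hU.mem_nhds hz)).restrict_scalars ℝ)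
  · refine (contDiffAt_const (c := (0 : ℂ))).congr_of_eventuallyEq ?_
    filter_upwards [hL.isOpen_compl.mem_nhds fun h => hz (hLU h)] with w hw
    rw [h0 w hw, zero_smul]

/-- Holomorphic functional calculus in a commutative complex Banach algebra, on the level of
characters. -/
theorem exists_forall_character_apply_eq {A : Type*} [NormedCommRing A] [NormedAlgebra ℂ A]
    [CompleteSpace A] (a : A) {U : Set ℂ} (hU : IsOpen U) (ha : spectrum ℂ a ⊆ U) {φ : ℂ → ℂ}
    (hφ : DifferentiableOn ℂ φ U) :
    ∃ b : A, ∀ χ : A →ₐ[ℂ] ℂ, χ b = φ (χ a) := by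
  obtain ⟨L, hLc, haL, hLU⟩ := exists_compact_between (spectrum.isCompact (𝕜 := ℂ) a) hU ha
  obtain ⟨ψ, hψ1, hψ0, -⟩ := exists_contMDiffMap_one_nhds_of_subset_interior
    (modelWithCornersSelf ℝ ℂ) (n := 1) (spectrum.isCompact (𝕜 := ℂ) a).isClosed haL
  have hψ : ContDiff ℝ 1 ψ := ψ.contMDiff.contDiff
  set g : ℂ → ℂ := fun z => ψ z • φ z with hgdef
  have hg : ContDiff ℝ 1 g := contDiff_smul_of_differentiableOn hU hLc.isClosed hLU hψ hψ0 hφ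
  have hgc : HasCompactSupport g :=
    HasCompactSupport.intro hLc fun z hz => by rw [hgdef]; simp [hψ0 z hz]
  have hgφ : ∀ z ∈ spectrum ℂ a, g =ᶠ[𝓝 z] φ := by
    intro z hz
    filter_upwards [mem_nhdsSet_iff_forall.1 hψ1 z hz] with w hw
    have hw : ψ w = 1 := hw
    simp [hgdef, hw]
  have hdb : ∀ z ∈ spectrum ℂ a, ∀ᶠ w in 𝓝 z, dbar g w = 0 := by
    intro z hz
    filter_upwards [(hgφ z hz).eventually_nhds, hU.mem_nhds (ha hz)] with w hw hwU
    exact dbar_eq_zero_of_eventuallyEq hw (hφ.differentiableAt (hU.mem_nhds hwU))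
  -- The resolvent is uncontrolled only at the spectrum, and g is holomorphic near it, so the
  -- integrand vanishes there.
  have hcont : Continuous fun z => dbar g z • resolvent a z := by
    rw [continuous_iff_continuousAt]
    intro z
    by_cases hz : z ∈ spectrum ℂ a
    · refine (continuousAt_const (y := (0 : A))).congr ?_
      filter_upwards [hdb z hz] with w hw
      rw [hw, zero_smul]
    · have hz' : z ∈ resolventSet ℂ a := not_not.1 hz
      exact (continuous_dbar hg).continuousAt.smul
        (spectrum.hasDerivAt_resolvent_const_left hz').continuousAt
  have hsupp : HasCompactSupport fun z => dbar g z • resolvent a z := by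
    refine HasCompactSupport.intro hgc fun z hz => ?_
    have : fderiv ℝ g z = 0 :=
      image_eq_zero_of_notMem_tsupport fun h => hz (tsupport_fderiv_subset ℝ h)
    simp [dbar, this]
  have hI := hcont.integrable_of_hasCompactSupport (μ := volume) hsupp
  -- Cauchy–Pompeiu with the kernel 1/(z - w) replaced by the resolvent. A character turns one
  -- kernel into the other, so no contour around the spectrum is needed.
  refine ⟨(-(Real.pi : ℂ)⁻¹) • ∫ z, dbar g z • resolvent a z, fun χ => ?_⟩
  have hχ : Continuous χ := (AlgHom.toContinuousLinearMap χ).continuous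
  have hmem : χ a ∈ spectrum ℂ a := AlgHom.apply_mem_spectrum χ a
  have hcomm := ContinuousLinearMap.integral_comp_comm
    (⟨χ.toLinearMap, hχ⟩ : A →L[ℂ] ℂ) hI
  have hval : ∀ z, χ (dbar g z • resolvent a z) = dbar g z / (z - χ a) := by
    intro z
    by_cases hz : z ∈ spectrum ℂ a
    · rw [(hdb z hz).self_of_nhds]; simp
    · have hz' : IsUnit (algebraMap ℂ A z - a) := not_not.1 hz
      have h1 : (z - χ a) * χ (resolvent a z) = 1 := by
        have : (algebraMap ℂ A z - a) * resolvent a z = 1 := Ring.mul_inverse_cancel _ hz'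
        have := congrArg χ this
        rwa [map_mul, map_sub, AlgHom.commutes, map_one] at this
      rw [map_smul, smul_eq_mul, eq_inv_of_mul_eq_one_right h1, div_eq_mul_inv]
  have hcomm' : ∫ z, dbar g z / (z - χ a) = χ (∫ z, dbar g z • resolvent a z) := by
    rw [← integral_congr_ae (Eventually.of_forall hval)]
    exact hcomm
  rw [map_smul, ← hcomm', integral_dbar_div_sub hg hgc, (hgφ _ hmem).eq_of_nhds, smul_eq_mul]
  have : (Real.pi : ℂ) ≠ 0 := by exact_mod_cast Real.pi_ne_zero
  field_simp

end FunctionalCalculus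

/-! ### The Banach algebra of a weighted semigroup. -/

section WeightedSemigroupAlgebra

theorem hasSum_norm_lp_one {M : Type*} (v : lp (fun _ : M => ℂ) 1) :
    HasSum (fun x => ‖v x‖) ‖v‖ := by
  simpa using lp.hasSum_norm (p := 1) (by simp) v

/-- The universal property of `ℓ¹`: a bounded family of vectors extends to a bounded operator. -/
noncomputable def lpOneLift {M F : Type*} [NormedAddCommGroup F] [NormedSpace ℂ F]
    [CompleteSpace F] (w : M → F) (C : ℝ) (hw : ∀ y, ‖w y‖ ≤ C) :
    lp (fun _ : M => ℂ) 1 →L[ℂ] F :=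
  have hb : ∀ v : lp (fun _ : M => ℂ) 1, ∀ y, ‖v y • w y‖ ≤ ‖v y‖ * C := fun v y => by
    rw [norm_smul]; exact mul_le_mul_of_nonneg_left (hw y) (norm_nonneg _)
  have hs : ∀ v : lp (fun _ : M => ℂ) 1, Summable fun y => v y • w y := fun v =>
    Summable.of_norm_bounded ((hasSum_norm_lp_one v).summable.mul_right C) (hb v)
  LinearMap.mkContinuous
    { toFun := fun v => ∑' y, v y • w y
      map_add' := fun u v => by
        rw [← (hs u).tsum_add (hs v)]
        exact tsum_congr fun y => add_smul _ _ _
      map_smul' := fun c v => by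
        rw [RingHom.id_apply, ← (hs v).tsum_const_smul]
        exact tsum_congr fun y => smul_assoc c (v y) (w y) } C
    (fun v => by
      rw [mul_comm]
      exact tsum_of_norm_bounded ((hasSum_norm_lp_one v).mul_right C) (hb v))

section

variable {M F : Type*} [NormedAddCommGroup F] [NormedSpace ℂ F] [CompleteSpace F] {w : M → F}
  {C : ℝ} (hw : ∀ y, ‖w y‖ ≤ C)

theorem lpOneLift_apply (v : lp (fun _ : M => ℂ) 1) :
    lpOneLift w C hw v = ∑' y, v y • w y := rfl

theorem norm_lpOneLift_le (hC : 0 ≤ C) : ‖lpOneLift w C hw‖ ≤ C := by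
  unfold lpOneLift
  exact LinearMap.mkContinuous_norm_le _ hC _

theorem lpOneLift_single [DecidableEq M] (y : M) (c : ℂ) :
    lpOneLift w C hw (lp.single 1 y c) = c • w y := by
  rw [lpOneLift_apply, tsum_eq_single y]
  · rw [lp.single_apply_self]
  · intro z hz
    rw [lp.single_apply_ne _ _ _ hz, zero_smul]

end

theorem lpOne_clm_ext {M F : Type*} [NormedAddCommGroup F] [NormedSpace ℂ F] [DecidableEq M]
    {S T : lp (fun _ : M => ℂ) 1 →L[ℂ] F}
    (h : ∀ y c, S (lp.single 1 y c) = T (lp.single 1 y c)) : S = T := by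
  refine lp.ext_continuousLinearMap ENNReal.one_ne_top fun y => ?_
  ext
  exact h y 1

open Classical in
/-- The translation operators by the elements of a weighted semigroup, acting on the weighted `ℓ¹`
space; the latter is identified with the unweighted one by scaling the coefficients. -/
noncomputable def weightedShift {M : Type*} [CommMonoid M] (ω : M → ℝ) (h1 : ∀ x, 1 ≤ ω x)
    (hmul : ∀ x y, ω (x * y) ≤ ω x * ω y) (x : M) :
    lp (fun _ : M => ℂ) 1 →L[ℂ] lp (fun _ : M => ℂ) 1 :=
  lpOneLift (fun y => lp.single 1 (x * y) ((ω (x * y) / ω y : ℝ) : ℂ)) (ω x) fun y => by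
    rw [lp.norm_single (by simp), Complex.norm_real, Real.norm_of_nonneg
      (div_nonneg (by linarith [h1 (x * y)]) (by linarith [h1 y])),
      div_le_iff₀ (by linarith [h1 y])]
    exact hmul x y

section

variable {M : Type*} [CommMonoid M] {ω : M → ℝ} (h1 : ∀ x, 1 ≤ ω x)
  (hmul : ∀ x y, ω (x * y) ≤ ω x * ω y)

open Classical in
theorem weightedShift_single (x y : M) (c : ℂ) :
    weightedShift ω h1 hmul x (lp.single 1 y c) =
      lp.single 1 (x * y) (c * (ω (x * y) / ω y : ℝ)) := by
  rw [weightedShift, lpOneLift_single, ← lp.single_smul, smul_eq_mul]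

theorem norm_weightedShift_le (x : M) : ‖weightedShift ω h1 hmul x‖ ≤ ω x :=
  norm_lpOneLift_le _ (by linarith [h1 x])

theorem weightedShift_one : weightedShift ω h1 hmul 1 = 1 := by
  classical
  refine lpOne_clm_ext fun y c => ?_
  have : ω y ≠ 0 := by linarith [h1 y]
  rw [weightedShift_single, one_mul, div_self this]
  simp

theorem weightedShift_mul (x y : M) :
    weightedShift ω h1 hmul (x * y) = weightedShift ω h1 hmul x * weightedShift ω h1 hmul y := by
  classical
  refine lpOne_clm_ext fun z c => ?_
  have : ω (y * z) ≠ 0 := by linarith [h1 (y * z)]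
  have : ω z ≠ 0 := by linarith [h1 z]
  rw [mul_apply_eq_comp, weightedShift_single, weightedShift_single,
    weightedShift_single, mul_assoc x, mul_assoc c, ← Complex.ofReal_mul]
  congr 4
  field_simp

/-- The evaluation of weighted series at a multiplicative function dominated by the weight. -/
noncomputable def weightedEval (χ : M →* ℂ) (hχ : ∀ x, ‖χ x‖ ≤ ω x) :
    lp (fun _ : M => ℂ) 1 →L[ℂ] ℂ :=
  lpOneLift (fun y => χ y / (ω y : ℂ)) 1 fun y => by
    have : 0 < ω y := by linarith [h1 y]
    rw [norm_div, Complex.norm_real, Real.norm_of_nonneg this.le, div_le_one this]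
    exact hχ y

theorem weightedEval_weightedShift (χ : M →* ℂ) (hχ : ∀ x, ‖χ x‖ ≤ ω x) (x : M)
    (v : lp (fun _ : M => ℂ) 1) :
    weightedEval h1 χ hχ (weightedShift ω h1 hmul x v) = χ x * weightedEval h1 χ hχ v := by
  classical
  suffices h : (weightedEval h1 χ hχ).comp (weightedShift ω h1 hmul x) =
      χ x • weightedEval h1 χ hχ from DFunLike.congr_fun h v
  refine lpOne_clm_ext fun y c => ?_
  have h2 : (ω (x * y) : ℂ) ≠ 0 := by
    exact_mod_cast (by linarith [h1 (x * y)] : ω (x * y) ≠ 0)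
  have h3 : (ω y : ℂ) ≠ 0 := by exact_mod_cast (by linarith [h1 y] : ω y ≠ 0)
  rw [ContinuousLinearMap.comp_apply, weightedShift_single, smul_apply,
    weightedEval, lpOneLift_single, lpOneLift_single, map_mul]
  simp only [smul_eq_mul, Complex.ofReal_div]
  field_simp

open Classical in
theorem weightedEval_unit (χ : M →* ℂ) (hχ : ∀ x, ‖χ x‖ ≤ ω x) :
    weightedEval h1 χ hχ (lp.single 1 1 (ω 1 : ℂ)) = 1 := by
  have h3 : (ω 1 : ℂ) ≠ 0 := by exact_mod_cast (by linarith [h1 1] : ω 1 ≠ 0)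
  rw [weightedEval, lpOneLift_single, map_one, smul_eq_mul, mul_one_div_cancel h3]

/-- The Banach algebra of a weighted semigroup, as an algebra of operators. -/
noncomputable def weightedAlgebra :
    Subalgebra ℂ (lp (fun _ : M => ℂ) 1 →L[ℂ] lp (fun _ : M => ℂ) 1) :=
  (Algebra.adjoin ℂ (Set.range (weightedShift ω h1 hmul))).topologicalClosure

theorem weightedShift_mem (x : M) :
    weightedShift ω h1 hmul x ∈ weightedAlgebra h1 hmul :=
  Subalgebra.le_topologicalClosure _ (Algebra.subset_adjoin ⟨x, rfl⟩)

theorem isClosed_weightedAlgebra :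
    IsClosed (weightedAlgebra h1 hmul : Set (lp (fun _ : M => ℂ) 1 →L[ℂ] lp (fun _ : M => ℂ) 1)) :=
  Subalgebra.isClosed_topologicalClosure _

theorem weightedAlgebra_mul_comm (S T : weightedAlgebra h1 hmul) : S * T = T * S := by
  have hc : ∀ S ∈ Set.range (weightedShift ω h1 hmul),
      ∀ T ∈ Set.range (weightedShift ω h1 hmul), S * T = T * S := by
    rintro _ ⟨x, rfl⟩ _ ⟨y, rfl⟩
    rw [← weightedShift_mul, ← weightedShift_mul, mul_comm]
  have hcomm := Algebra.isMulCommutative_adjoin ℂ hc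
  let := Subalgebra.commRingTopologicalClosure
    (Algebra.adjoin ℂ (Set.range (weightedShift ω h1 hmul))) fun x y => hcomm.is_comm.comm x y
  exact this.mul_comm S T

noncomputable instance : NormedCommRing (weightedAlgebra h1 hmul) where
  __ := (inferInstance : NormedRing (weightedAlgebra h1 hmul))
  mul_comm := weightedAlgebra_mul_comm h1 hmul

noncomputable instance : NormedAlgebra ℂ (weightedAlgebra h1 hmul) where
  __ := (inferInstance : Algebra ℂ (weightedAlgebra h1 hmul))
  norm_smul_le c T := norm_smul_le c T.1

instance : CompleteSpace (weightedAlgebra h1 hmul) :=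
  (isClosed_weightedAlgebra h1 hmul).completeSpace_coe

-- This makes evaluation at the unit vector multiplicative on the algebra. The identity holds for
-- translations and survives algebra operations and norm limits.
open Classical in
theorem weightedEval_apply_mem_weightedAlgebra (χ : M →* ℂ) (hχ : ∀ x, ‖χ x‖ ≤ ω x)
    {T : lp (fun _ : M => ℂ) 1 →L[ℂ] lp (fun _ : M => ℂ) 1} (hT : T ∈ weightedAlgebra h1 hmul)
    (v : lp (fun _ : M => ℂ) 1) :
    weightedEval h1 χ hχ (T v) =
      weightedEval h1 χ hχ (T (lp.single 1 1 (ω 1 : ℂ))) * weightedEval h1 χ hχ v := by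
  set u : lp (fun _ : M => ℂ) 1 := lp.single 1 1 (ω 1 : ℂ) with hu
  have hu1 : weightedEval h1 χ hχ u = 1 := weightedEval_unit h1 χ hχ
  have hclosed : IsClosed {T : lp (fun _ : M => ℂ) 1 →L[ℂ] lp (fun _ : M => ℂ) 1 |
      ∀ v, weightedEval h1 χ hχ (T v) =
        weightedEval h1 χ hχ (T u) * weightedEval h1 χ hχ v} := by
    rw [Set.ofPred_forall]
    refine isClosed_iInter fun v => isClosed_eq ?_ ?_
    · fun_prop
    · fun_prop
  refine closure_minimal ?_ hclosed hT v
  intro S hS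
  refine Algebra.adjoin_induction (p := fun S _ => ∀ v, weightedEval h1 χ hχ (S v) =
        weightedEval h1 χ hχ (S u) * weightedEval h1 χ hχ v) ?_ ?_ ?_ ?_ hS
  · rintro _ ⟨x, rfl⟩ v
    rw [weightedEval_weightedShift, weightedEval_weightedShift, hu1, mul_one]
  · intro c v
    rw [Algebra.algebraMap_eq_smul_one, smul_apply, smul_apply, one_apply_eq_self,
      one_apply_eq_self, map_smul, map_smul, hu1]
    simp
  · intro S T _ _ hS hT v
    rw [add_apply, add_apply, map_add, map_add, hS, hT, add_mul]
  · intro S T _ _ hS hT v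
    rw [mul_apply_eq_comp, mul_apply_eq_comp, hS, hT, hS (T u), mul_assoc]

open Classical in
/-- The character of the weighted algebra given by a multiplicative function dominated by the
weight. -/
noncomputable def weightedCharacter (χ : M →* ℂ) (hχ : ∀ x, ‖χ x‖ ≤ ω x) :
    weightedAlgebra h1 hmul →ₐ[ℂ] ℂ :=
  AlgHom.ofLinearMap
    { toFun := fun T => weightedEval h1 χ hχ (T.1 (lp.single 1 1 (ω 1 : ℂ)))
      map_add' := fun S T => by
        rw [← map_add]; rfl
      map_smul' := fun c T => by
        rw [RingHom.id_apply, ← map_smul]; rfl }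
    (weightedEval_unit h1 χ hχ)
    (fun S T => weightedEval_apply_mem_weightedAlgebra h1 hmul χ hχ S.2 _)

/-- The semigroup of translations inside the weighted algebra. -/
noncomputable def weightedShiftHom : M →* weightedAlgebra h1 hmul where
  toFun x := ⟨weightedShift ω h1 hmul x, weightedShift_mem h1 hmul x⟩
  map_one' := Subtype.ext (weightedShift_one h1 hmul)
  map_mul' x y := Subtype.ext (weightedShift_mul h1 hmul x y)

theorem weightedCharacter_shift (χ : M →* ℂ) (hχ : ∀ x, ‖χ x‖ ≤ ω x) (x : M) :
    weightedCharacter h1 hmul χ hχ (weightedShiftHom h1 hmul x) = χ x := by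
  change weightedEval h1 χ hχ (weightedShift ω h1 hmul x _) = χ x
  rw [weightedEval_weightedShift, weightedEval_unit, mul_one]

end

/-- Holomorphic functional calculus for a series over a bounded representation of a semigroup in a
commutative Banach algebra. -/
theorem exists_forall_character_apply_eq_tsum {M A : Type*} [CommMonoid M] [NormedCommRing A]
    [NormedAlgebra ℂ A] [CompleteSpace A] (hA : ‖(1 : A)‖ ≤ 1) {ω : M → ℝ} {σ : M →* A}
    (hσ : ∀ x, ‖σ x‖ ≤ ω x) {a : M → ℂ} (ha : Summable fun x => ‖a x‖ * ω x) {U : Set ℂ}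
    (hU : IsOpen U) (haU : ∀ χ : M →* ℂ, (∀ x, ‖χ x‖ ≤ ω x) → ∑' x, a x * χ x ∈ U) {φ : ℂ → ℂ}
    (hφ : DifferentiableOn ℂ φ U) :
    ∃ b : A, ∀ ψ : A →ₐ[ℂ] ℂ, ψ b = φ (∑' x, a x * ψ (σ x)) := by
  have hs : Summable fun x => a x • σ x := by
    refine Summable.of_norm_bounded ha fun x => ?_
    rw [norm_smul]
    exact mul_le_mul_of_nonneg_left (hσ x) (norm_nonneg _)
  have hψ : ∀ ψ : A →ₐ[ℂ] ℂ, ψ (∑' x, a x • σ x) = ∑' x, a x * ψ (σ x) := by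
    intro ψ
    have := hs.hasSum.map ψ (AlgHom.toContinuousLinearMap ψ).continuous
    rw [← this.tsum_eq]
    exact tsum_congr fun x => by simp
  -- By Gelfand theory spectral values are values of characters. As ‖1‖ ≤ 1, characters are
  -- contractive, so they restrict to multiplicative functions on M dominated by `ω`.
  have hspec : spectrum ℂ (∑' x, a x • σ x) ⊆ U := by
    intro z hz
    obtain ⟨f, rfl⟩ := WeakDual.CharacterSpace.mem_spectrum_iff_exists.1 hz
    rw [← WeakDual.CharacterSpace.equivAlgHom_coe f, hψ]
    refine haU ((WeakDual.CharacterSpace.equivAlgHom f : A →* ℂ).comp σ) fun x => ?_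
    refine (AlgHom.norm_apply_le_self_mul_norm_one (WeakDual.CharacterSpace.equivAlgHom f)
      (σ x)).trans ?_
    calc ‖σ x‖ * ‖(1 : A)‖ ≤ ‖σ x‖ := mul_le_of_le_one_right (norm_nonneg _) hA
      _ ≤ ω x := hσ x
  obtain ⟨b, hb⟩ := exists_forall_character_apply_eq _ hU hspec hφ
  exact ⟨b, fun ψ => by rw [hb, hψ]⟩

/-- Holomorphic functional calculus for absolutely convergent series over a weighted semigroup. -/
theorem exists_summable_comp_of_differentiableOn {M : Type*} [CommMonoid M] {ω : M → ℝ}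
    (h1 : ∀ x, 1 ≤ ω x) (hmul : ∀ x y, ω (x * y) ≤ ω x * ω y) {a : M → ℂ}
    (ha : Summable fun x => ‖a x‖ * ω x) {U : Set ℂ} (hU : IsOpen U)
    (haU : ∀ χ : M →* ℂ, (∀ x, ‖χ x‖ ≤ ω x) → ∑' x, a x * χ x ∈ U) {φ : ℂ → ℂ}
    (hφ : DifferentiableOn ℂ φ U) :
    ∃ b : M → ℂ, (Summable fun x => ‖b x‖ * ω x) ∧
      ∀ χ : M →* ℂ, (∀ x, ‖χ x‖ ≤ ω x) →
        HasSum (fun x => b x * χ x) (φ (∑' x, a x * χ x)) := by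
  classical
  obtain ⟨B, hB⟩ := exists_forall_character_apply_eq_tsum (A := weightedAlgebra h1 hmul)
    ContinuousLinearMap.norm_id_le (σ := weightedShiftHom h1 hmul)
    (norm_weightedShift_le h1 hmul) ha hU haU hφ
  -- Coordinates in ℓ¹ are coefficients times `ω`: the unit is the vector ω(1)δ₁, and the
  -- coefficients of the operator are recovered as `v` divided by `ω`.
  set v : lp (fun _ : M => ℂ) 1 := B.1 (lp.single 1 1 (ω 1 : ℂ)) with hv
  have hω : ∀ x, 0 < ω x := fun x => by linarith [h1 x]
  refine ⟨fun x => v x / ω x, ?_, fun χ hχ => ?_⟩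
  · refine (hasSum_norm_lp_one v).summable.congr fun x => ?_
    rw [norm_div, Complex.norm_real, Real.norm_of_nonneg (hω x).le,
      div_mul_cancel₀ _ (hω x).ne']
  · have h := hB (weightedCharacter h1 hmul χ hχ)
    simp only [weightedCharacter_shift] at h
    have h4 : ∑' x, v x • (χ x / (ω x : ℂ)) = φ (∑' x, a x * χ x) := h
    have h5 : Summable fun x => v x • (χ x / (ω x : ℂ)) := by
      refine Summable.of_norm_bounded (hasSum_norm_lp_one v).summable fun x => ?_
      rw [norm_smul, norm_div, Complex.norm_real, Real.norm_of_nonneg (hω x).le]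
      exact mul_le_of_le_one_right (norm_nonneg _) ((div_le_one (hω x)).2 (hχ x))
    rw [← h4]
    convert h5.hasSum using 2 with x
    rw [smul_eq_mul]
    ring

end WeightedSemigroupAlgebra

/-! ### Kronecker's theorem by averaging along a line on the torus. -/

section Kronecker

open MeasureTheory UnitAddTorus

/-- The winding of the line in direction `v` around the torus. -/
noncomputable def torusWinding {ι : Type*} (v : ι → ℝ) (t : ℝ) : UnitAddTorus ι :=
  fun i => ((t * v i : ℝ) : UnitAddCircle)

theorem continuous_torusWinding {ι : Type*} (v : ι → ℝ) : Continuous (torusWinding v) :=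
  continuous_pi fun i => (AddCircle.continuous_mk' 1).comp (by fun_prop)

variable {ι : Type*} [Fintype ι]

theorem isProbabilityMeasure_volume_unitAddTorus :
    IsProbabilityMeasure (volume : Measure (UnitAddTorus ι)) := by
  have : IsProbabilityMeasure (volume : Measure UnitAddCircle) := ⟨UnitAddCircle.measure_univ⟩
  exact Measure.pi.instIsProbabilityMeasure _

theorem mFourier_torusWinding (v : ι → ℝ) (n : ι → ℤ) (t : ℝ) :
    mFourier n (torusWinding v t)
      = Complex.exp ((2 * Real.pi * (∑ i, n i * v i : ℝ) * Complex.I) * t) := by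
  simp only [mFourier, ContinuousMap.coe_mk, torusWinding]
  rw [Finset.prod_congr rfl fun i _ => fourier_coe_apply, ← Complex.exp_sum]
  congr 1
  push_cast
  rw [Finset.mul_sum, Finset.sum_mul, Finset.sum_mul]
  refine Finset.sum_congr rfl fun i _ => ?_
  ring

theorem mFourier_apply_add (n : ι → ℤ) (x y : UnitAddTorus ι) :
    mFourier n (x + y) = mFourier n x * mFourier n y := by
  simp only [mFourier, ContinuousMap.coe_mk, ← Finset.prod_mul_distrib]
  refine Finset.prod_congr rfl fun i _ => ?_
  simp [fourier_apply, smul_add, AddCircle.toCircle_add]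

/-- Translation by a point where the Fourier character equals -1 preserves the integral and changes
its sign. -/
theorem integral_mFourier_eq_zero {v : ι → ℝ} {n : ι → ℤ} (hn : ∑ i, n i * v i ≠ 0) :
    ∫ x : UnitAddTorus ι, mFourier n x = 0 := by
  set c : ℝ := ∑ i, n i * v i with hc
  have h1 : mFourier n (torusWinding v (1 / (2 * c))) = -1 := by
    rw [mFourier_torusWinding, ← hc, ← Complex.exp_pi_mul_I]
    congr 1
    have : (c : ℂ) ≠ 0 := by exact_mod_cast hn
    push_cast
    field_simp
  have h2 := integral_add_right_eq_self (μ := (volume : Measure (UnitAddTorus ι)))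
    (fun x => mFourier n x) (torusWinding v (1 / (2 * c)))
  simp only [mFourier_apply_add, h1, mul_neg, mul_one, integral_neg] at h2
  linear_combination (-1 / 2 : ℂ) * h2

theorem norm_intervalIntegral_exp_le {c : ℝ} (hc : c ≠ 0) (T : ℝ) :
    ‖∫ t in (0 : ℝ)..T, Complex.exp ((c * Complex.I) * t)‖ ≤ 2 / |c| := by
  have hc' : (c : ℂ) * Complex.I ≠ 0 := mul_ne_zero (by exact_mod_cast hc) Complex.I_ne_zero
  rw [integral_exp_mul_complex hc', norm_div]
  have h1 : ‖(c : ℂ) * Complex.I‖ = |c| := by simp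
  rw [h1]
  gcongr
  refine (norm_sub_le _ _).trans ?_
  have h2 : ∀ t : ℝ, ‖Complex.exp (c * Complex.I * t)‖ = 1 := fun t => by
    rw [show (c : ℂ) * Complex.I * t = ((c * t : ℝ) : ℂ) * Complex.I by push_cast; ring]
    exact Complex.norm_exp_ofReal_mul_I _
  rw [h2, h2]
  norm_num

/-- Weyl equidistribution for trigonometric polynomials. A nonzero frequency oscillates along the
line, so its mean is O(1/T), in agreement with its zero integral. -/
theorem tendsto_mean_torusWinding {v : ι → ℝ}
    (hv : ∀ n : ι → ℤ, ∑ i, n i * v i = 0 → n = 0) {q : C(UnitAddTorus ι, ℂ)}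
    (hq : q ∈ Submodule.span ℂ (Set.range (mFourier (d := ι)))) :
    Tendsto (fun T : ℝ => (T : ℂ)⁻¹ * ∫ t in (0 : ℝ)..T, q (torusWinding v t)) atTop
      (𝓝 (∫ x, q x)) := by
  have := isProbabilityMeasure_volume_unitAddTorus (ι := ι)
  have hcont : ∀ f : C(UnitAddTorus ι, ℂ), Continuous fun t => f (torusWinding v t) := fun f =>
    f.continuous.comp (continuous_torusWinding v)
  have hinteg : ∀ f : C(UnitAddTorus ι, ℂ), Integrable f (volume : Measure (UnitAddTorus ι)) :=
    fun f => f.continuous.integrable_of_hasCompactSupport (HasCompactSupport.of_compactSpace f)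
  induction hq using Submodule.span_induction with
  | mem f hf =>
    obtain ⟨n, rfl⟩ := hf
    by_cases hn : ∑ i, n i * v i = 0
    · rw [hv n hn, mFourier_zero]
      simp only [ContinuousMap.one_apply]
      refine tendsto_const_nhds.congr' ?_
      filter_upwards [eventually_gt_atTop 0] with T hT
      have : (T : ℂ) ≠ 0 := by exact_mod_cast hT.ne'
      simp [this]
    · rw [integral_mFourier_eq_zero hn]
      simp only [mFourier_torusWinding]
      set c : ℝ := 2 * Real.pi * ∑ i, n i * v i with hc
      have hc0 : c ≠ 0 := mul_ne_zero (by positivity) hn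
      have e : (2 * Real.pi * ((∑ i, n i * v i : ℝ) : ℂ) * Complex.I) = c * Complex.I := by
        rw [hc]; push_cast; ring
      rw [e]
      refine squeeze_zero_norm' (a := fun T : ℝ => T⁻¹ * (2 / |c|)) ?_ ?_
      · filter_upwards [eventually_gt_atTop 0] with T hT
        rw [norm_mul, norm_inv, Complex.norm_real, Real.norm_of_nonneg hT.le]
        gcongr
        exact norm_intervalIntegral_exp_le hc0 T
      · simpa using tendsto_inv_atTop_zero.mul_const (2 / |c|)
  | zero => simp
  | add f g _ _ hf hg =>
    refine ((hf.add hg).congr fun T => ?_).trans (le_of_eq ?_)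
    · rw [← mul_add, ← intervalIntegral.integral_add ((hcont f).intervalIntegrable _ _)
        ((hcont g).intervalIntegrable _ _)]
      rfl
    · rw [← integral_add (hinteg f) (hinteg g)]
      rfl
  | smul c f _ hf =>
    refine ((hf.const_mul c).congr fun T => ?_).trans (le_of_eq ?_)
    · rw [mul_left_comm, ← intervalIntegral.integral_const_mul]
      rfl
    · rw [← integral_const_mul]
      rfl

/-- **Kronecker's approximation theorem**: a line whose direction has rationally independent
coordinates winds densely around the torus. -/
theorem denseRange_torusWinding {v : ι → ℝ} (hv : ∀ n : ι → ℤ, ∑ i, n i * v i = 0 → n = 0) :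
    DenseRange (torusWinding v) := by
  have := isProbabilityMeasure_volume_unitAddTorus (ι := ι)
  by_contra hd
  obtain ⟨θ, hθ⟩ : ∃ θ, θ ∉ closure (Set.range (torusWinding v)) := by
    simpa [DenseRange, Dense] using hd
  set F : UnitAddTorus ι → ℝ := fun x => Metric.infDist x (closure (Set.range (torusWinding v)))
    with hF
  have hFc : Continuous F := Metric.continuous_infDist_pt _
  have hne : (closure (Set.range (torusWinding v))).Nonempty :=
    (Set.range_nonempty _).closure
  have hFθ : F θ ≠ 0 := ((isClosed_closure.notMem_iff_infDist_pos hne).1 hθ).ne'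
  have hpos : 0 < ∫ x, F x :=
    hFc.integral_pos_of_hasCompactSupport_nonneg_nonzero (HasCompactSupport.of_compactSpace F)
      (fun x => Metric.infDist_nonneg) hFθ
  have hF0 : ∀ t, F (torusWinding v t) = 0 := fun t =>
    Metric.infDist_zero_of_mem (subset_closure ⟨t, rfl⟩)
  obtain ⟨G, hG⟩ : ∃ G : C(UnitAddTorus ι, ℂ), ∀ x, G x = F x :=
    ⟨⟨fun x => (F x : ℂ), Complex.continuous_ofReal.comp hFc⟩, fun x => rfl⟩
  have hGm : G ∈ closure (Submodule.span ℂ (Set.range (mFourier (d := ι))) :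
      Set C(UnitAddTorus ι, ℂ)) := by
    rw [← Submodule.topologicalClosure_coe, span_mFourier_closure_eq_top]
    trivial
  -- The distance `F` vanishes on the line, so means of an ε-close polynomial q are at most ε in
  -- norm. Hence |∫ q| ≤ ε and ∫ F ≤ 2ε, against ∫ F = 3ε > 0.
  obtain ⟨ε, hε⟩ : ∃ ε, ε = (∫ x, F x) / 3 := ⟨_, rfl⟩
  have hε0 : 0 < ε := by rw [hε]; exact div_pos hpos three_pos
  obtain ⟨q, hq, hGq⟩ := Metric.mem_closure_iff.1 hGm ε hε0
  rw [dist_eq_norm] at hGq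
  have hpt : ∀ x, ‖G x - q x‖ ≤ ε := fun x =>
    (ContinuousMap.norm_coe_le_norm (G - q) x).trans hGq.le
  have hinteg : ∀ f : C(UnitAddTorus ι, ℂ), Integrable f (volume : Measure (UnitAddTorus ι)) :=
    fun f => f.continuous.integrable_of_hasCompactSupport (HasCompactSupport.of_compactSpace f)
  have h1 : ‖∫ x, q x‖ ≤ ε := by
    refine le_of_tendsto (tendsto_mean_torusWinding hv hq).norm ?_
    filter_upwards [eventually_gt_atTop 0] with T hT
    have := intervalIntegral.norm_integral_le_of_norm_le_const (a := 0) (b := T) (C := ε)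
      (f := fun t => q (torusWinding v t)) fun t _ => by
        have h := hpt (torusWinding v t)
        rw [hG, hF0, Complex.ofReal_zero, zero_sub, norm_neg] at h
        exact h
    rw [norm_mul, norm_inv, Complex.norm_real, Real.norm_of_nonneg hT.le]
    rw [sub_zero, abs_of_pos hT] at this
    rw [inv_mul_le_iff₀ hT, mul_comm T]
    exact this
  have h2 : ‖∫ x, (G x - q x)‖ ≤ ε := by
    have := norm_integral_le_of_norm_le_const (μ := (volume : Measure (UnitAddTorus ι)))
      (Eventually.of_forall hpt)
    simpa using this
  rw [integral_sub (hinteg G) (hinteg q)] at h2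
  have h3 : ∫ x, G x = ((∫ x, F x : ℝ) : ℂ) := by
    simp only [hG]
    exact integral_ofReal
  have h4 : ‖∫ x, G x‖ = ∫ x, F x := by
    rw [h3, Complex.norm_real, Real.norm_of_nonneg hpos.le]
  have h5 := norm_sub_norm_le (∫ x, G x) (∫ x, q x)
  linarith

end Kronecker

/-! ### Multiplicative functions as points of the polydisc over the primes. -/

section PrimeEval

/-- The completely multiplicative function with given values at the primes. -/
noncomputable def primeEval {R : Type*} [CommMonoid R] (z : Nat.Primes → R) : ℕ+ →* R where
  toFun n := (Multiset.map z n.factorMultiset).prod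
  map_one' := by
    rw [PNat.factorMultiset_one]
    exact Multiset.prod_zero
  map_mul' m n := by
    rw [PNat.factorMultiset_mul]
    exact (congrArg _ (Multiset.map_add _ _ _)).trans (Multiset.prod_add _ _)

theorem primeEval_apply {R : Type*} [CommMonoid R] (z : Nat.Primes → R) (n : ℕ+) :
    primeEval z n = (Multiset.map z n.factorMultiset).prod := rfl

theorem primeEval_eq {R : Type*} [CommMonoid R] (χ : ℕ+ →* R) :
    primeEval (fun p => χ p) = χ := by
  ext n
  conv_rhs => rw [← PNat.prod_factorMultiset n]
  rw [primeEval_apply, PrimeMultiset.prod, map_multiset_prod, PrimeMultiset.toPNatMultiset]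
  exact congrArg Multiset.prod (Multiset.map_map _ _ _).symm

theorem norm_primeEval_le_one {z : Nat.Primes → ℂ} (hz : ∀ p, ‖z p‖ ≤ 1) (n : ℕ+) :
    ‖primeEval z n‖ ≤ 1 := by
  rw [primeEval_apply]
  induction (n.factorMultiset : Multiset Nat.Primes) using Multiset.induction with
  | empty => simp
  | cons p s ih =>
    rw [Multiset.map_cons, Multiset.prod_cons, norm_mul]
    exact mul_le_one₀ (hz p) (norm_nonneg _) ih

theorem continuous_primeEval (n : ℕ+) : Continuous fun z : Nat.Primes → ℂ => primeEval z n := by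
  simp only [primeEval_apply]
  exact continuous_multiset_prod (n.factorMultiset : Multiset Nat.Primes) fun p _ =>
    continuous_apply p

theorem differentiable_primeEval {z : Nat.Primes → ℂ → ℂ} (hz : ∀ p, Differentiable ℂ (z p))
    (n : ℕ+) : Differentiable ℂ fun s => primeEval (fun p => z p s) n := by
  simp only [primeEval_apply]
  induction (n.factorMultiset : Multiset Nat.Primes) using Multiset.induction with
  | empty => simp
  | cons p s ih =>
    simp only [Multiset.map_cons, Multiset.prod_cons]
    exact (hz p).mul ih

/-- The function `n ↦ n ^ (-s)` as a homomorphism. -/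
noncomputable def cpowHom (s : ℂ) : ℕ+ →* ℂ where
  toFun n := ((n : ℕ) : ℂ) ^ (-s)
  map_one' := by simp
  map_mul' m n := by
    rw [PNat.mul_coe, Nat.cast_mul, Complex.natCast_mul_natCast_cpow]

theorem norm_cpowHom_le_one {s : ℂ} (hs : 0 ≤ s.re) (n : ℕ+) : ‖cpowHom s n‖ ≤ 1 := by
  change ‖((n : ℕ) : ℂ) ^ (-s)‖ ≤ 1
  rw [Complex.norm_natCast_cpow_of_pos n.pos]
  refine Real.rpow_le_one_of_one_le_of_nonpos ?_ (by simpa using hs)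
  exact_mod_cast n.pos

/-- The unit polydisc over the primes. -/
def primePolydisc : Set (Nat.Primes → ℂ) := {z | ∀ p, ‖z p‖ ≤ 1}

theorem norm_mul_primeEval_le (a : ℕ+ → ℂ) {z : Nat.Primes → ℂ} (hz : z ∈ primePolydisc)
    (n : ℕ+) : ‖a n * primeEval z n‖ ≤ ‖a n‖ := by
  rw [norm_mul]
  exact mul_le_of_le_one_right (norm_nonneg _) (norm_primeEval_le_one hz n)

theorem continuousOn_tsum_primeEval {a : ℕ+ → ℂ} (ha : Summable fun n => ‖a n‖) :
    ContinuousOn (fun z => ∑' n, a n * primeEval z n) primePolydisc :=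
  continuousOn_tsum (fun n => (continuous_const.mul (continuous_primeEval n)).continuousOn) ha
    fun n _ hz => norm_mul_primeEval_le a hz n

end PrimeEval

/-! ### Density of the vertical line in the torus over the primes. -/

section PrimeTorus

/-- Unique factorization: separating positive and negative parts of the exponents gives two equal
products of prime powers. -/
theorem eq_zero_of_sum_mul_log_primes {I : Finset Nat.Primes} {n : I → ℤ}
    (h : ∑ p, (n p : ℝ) * Real.log (p.1 : ℕ) = 0) : n = 0 := by
  have hprod : ∀ m : I → ℕ, ∑ p, (m p : ℝ) * Real.log (p.1 : ℕ)
      = Real.log ((∏ p, (p.1 : ℕ) ^ m p : ℕ) : ℝ) := by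
    intro m
    push_cast
    rw [Real.log_prod fun p _ => pow_ne_zero _ (by exact_mod_cast p.1.2.ne_zero)]
    exact Finset.sum_congr rfl fun p _ => (Real.log_pow _ _).symm
  have hpos : ∀ m : I → ℕ, 0 < ∏ p, (p.1 : ℕ) ^ m p := fun m =>
    Finset.prod_pos fun p _ => pow_pos p.1.2.pos _
  have hfac : ∀ (m : I → ℕ) (q : I), (∏ p, (p.1 : ℕ) ^ m p).factorization (q.1 : ℕ) = m q := by
    intro m q
    rw [Nat.factorization_prod fun p _ => pow_ne_zero _ p.1.2.ne_zero, Finsupp.finsetSum_apply,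
      Finset.sum_eq_single q]
    · rw [q.1.2.factorization_pow, Finsupp.single_eq_same]
    · intro p _ hpq
      rw [p.1.2.factorization_pow, Finsupp.single_eq_of_ne]
      exact fun h => hpq (Subtype.ext (Subtype.ext h.symm))
    · simp
  have hsplit : ∑ p, ((n p).toNat : ℝ) * Real.log (p.1 : ℕ)
      = ∑ p, ((-n p).toNat : ℝ) * Real.log (p.1 : ℕ) := by
    rw [← sub_eq_zero, ← Finset.sum_sub_distrib, ← h]
    refine Finset.sum_congr rfl fun p _ => ?_
    rw [← sub_mul]
    congr 1
    have := Int.toNat_sub_toNat_neg (n p)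
    exact_mod_cast this
  rw [hprod, hprod] at hsplit
  have heq := Real.log_injOn_pos (Set.mem_Ioi.2 (by exact_mod_cast hpos _))
    (Set.mem_Ioi.2 (by exact_mod_cast hpos _)) hsplit
  have heq' : ∏ p, (p.1 : ℕ) ^ (n p).toNat = ∏ p, (p.1 : ℕ) ^ (-n p).toNat := by
    exact_mod_cast heq
  funext q
  have := congrArg (fun m => m.factorization (q.1 : ℕ)) heq'
  simp only [hfac] at this
  have h3 := Int.toNat_sub_toNat_neg (n q)
  rw [this, sub_self] at h3
  exact h3.symm

/-- The points `(p ^ (-it))` are dense in the torus over the primes. -/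
theorem mem_closure_range_cpow {θ : Nat.Primes → ℂ} (hθ : ∀ p, ‖θ p‖ = 1) :
    θ ∈ closure (Set.range fun t : ℝ => fun p : Nat.Primes => cpowHom (t * Complex.I) p) := by
  rw [mem_closure_iff_nhds]
  intro V hV
  rw [nhds_pi, Filter.mem_pi] at hV
  obtain ⟨I, hI, W, hW, hWV⟩ := hV
  obtain ⟨I, rfl⟩ := hI.exists_finset_coe
  -- Chosen so that exp(2πi t v_p) = p^(-it).
  let v : I → ℝ := fun p => -Real.log (p.1 : ℕ) / (2 * Real.pi)
  have hv : ∀ n : I → ℤ, ∑ i, n i * v i = 0 → n = 0 := by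
    intro n hn
    apply eq_zero_of_sum_mul_log_primes
    have h2 : ∑ p, (n p : ℝ) * Real.log (p.1 : ℕ) = -(2 * Real.pi) * ∑ i, n i * v i := by
      rw [Finset.mul_sum]
      refine Finset.sum_congr rfl fun p _ => ?_
      simp only [v]
      field_simp
    rw [h2, hn, mul_zero]
  let Φ : UnitAddTorus I → I → ℂ := fun x p => (AddCircle.toCircle (x p) : ℂ)
  have hΦ : Continuous Φ := by
    refine continuous_pi fun p => ?_
    exact continuous_subtype_val.comp (AddCircle.continuous_toCircle.comp (continuous_apply p))
  have hx : ∀ p, ∃ x : UnitAddCircle, (AddCircle.toCircle x : ℂ) = θ p := by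
    intro p
    have hp : θ p ∈ Submonoid.unitSphere ℂ := by simp [Submonoid.unitSphere, hθ p]
    obtain ⟨x, hx⟩ := (AddCircle.homeomorphCircle one_ne_zero).surjective (⟨θ p, hp⟩ : Circle)
    exact ⟨x, by rw [← AddCircle.homeomorphCircle_apply one_ne_zero, hx]⟩
  choose x hx using hx
  have hopen : {y : UnitAddTorus I | ∀ p : I, Φ y p ∈ W p} ∈ 𝓝 (fun p : I => x p) := by
    rw [Set.ofPred_forall, Filter.iInter_mem]
    intro p
    exact ((continuous_apply p).comp hΦ).continuousAt.preimage_mem_nhds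
      (by simpa [Φ, hx] using hW p)
  obtain ⟨_, hy, t, rfl⟩ := mem_closure_iff_nhds.1 (denseRange_torusWinding hv _) _ hopen
  refine ⟨_, hWV fun p hp => ?_, t, rfl⟩
  have := hy ⟨p, hp⟩
  convert this using 1
  simp only [Φ, torusWinding, v]
  rw [AddCircle.toCircle_apply_mk, Circle.coe_exp]
  change ((p : ℕ) : ℂ) ^ (-(t * Complex.I)) = _
  rw [Complex.cpow_def_of_ne_zero (by exact_mod_cast p.2.ne_zero), ← Complex.natCast_log]
  congr 1
  have : (Real.pi : ℂ) ≠ 0 := by exact_mod_cast Real.pi_ne_zero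
  push_cast
  field_simp

end PrimeTorus

/-! ### Persistence of a value under deformation of the exponents. -/

section ZeroTracking

theorem isCompact_primeTorus : IsCompact {θ : Nat.Primes → ℂ | ∀ p, ‖θ p‖ = 1} := by
  have : {θ : Nat.Primes → ℂ | ∀ p, ‖θ p‖ = 1} = Set.univ.pi fun _ => Metric.sphere 0 1 := by
    ext θ; simp
  rw [this]
  exact isCompact_univ_pi fun _ => isCompact_sphere 0 1

theorem norm_mul_rpow_le_one {w : ℂ} {u y : ℝ} (hw : ‖w‖ = 1) (hu : u ∈ Set.Icc (0 : ℝ) 1)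
    (hy : 0 ≤ y) : ‖w * ((u ^ y : ℝ) : ℂ)‖ ≤ 1 := by
  rw [norm_mul, hw, one_mul, Complex.norm_real, Real.norm_of_nonneg (Real.rpow_nonneg hu.1 _)]
  exact Real.rpow_le_one hu.1 hu.2 hy

theorem norm_mul_exp_le_one {w s : ℂ} {y : ℝ} (hw : ‖w‖ = 1) (hs : 0 ≤ s.re) (hy : 0 ≤ y) :
    ‖w * Complex.exp (-(y * s))‖ ≤ 1 := by
  rw [norm_mul, hw, one_mul, Complex.norm_exp]
  refine Real.exp_le_one_iff.2 ?_
  simpa using mul_nonneg hy hs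

variable {a : ℕ+ → ℂ} {c : ℂ} {y : ℝ → Nat.Primes → ℝ}

/-- The parameter set is the projection of a closed subset of a compact set of triples (τ, u, θ).
Positivity of the exponents keeps u^y continuous down to u = 0. -/
theorem isClosed_value_parameters (ha : Summable fun n => ‖a n‖)
    (hy0 : ∀ τ p, 0 < y τ p) (hyc : ∀ p, Continuous fun τ => y τ p) :
    IsClosed ({τ : ℝ | ∃ θ : Nat.Primes → ℂ, (∀ p, ‖θ p‖ = 1) ∧ ∃ u ∈ Set.Icc (0 : ℝ) 1,
      ∑' n, a n * primeEval (fun p => θ p * ((u ^ y τ p : ℝ) : ℂ)) n = c} ∩ Set.Icc 0 1) := by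
  set K : Set (ℝ × ℝ × (Nat.Primes → ℂ)) :=
    Set.Icc 0 1 ×ˢ Set.Icc 0 1 ×ˢ {θ | ∀ p, ‖θ p‖ = 1} with hK
  have hKc : IsCompact K := isCompact_Icc.prod (isCompact_Icc.prod isCompact_primeTorus)
  set Z : ℝ × ℝ × (Nat.Primes → ℂ) → Nat.Primes → ℂ :=
    fun q p => q.2.2 p * ((q.2.1 ^ y q.1 p : ℝ) : ℂ) with hZ
  have hZc : ContinuousOn Z K := by
    refine continuousOn_pi.2 fun p => ContinuousOn.mul (by fun_prop) ?_
    refine Complex.continuous_ofReal.comp_continuousOn ?_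
    refine ContinuousOn.rpow (by fun_prop) ?_ fun q _ => Or.inr (hy0 _ _)
    exact ((hyc p).comp continuous_fst).continuousOn
  have hZm : Set.MapsTo Z K primePolydisc := fun q hq p =>
    norm_mul_rpow_le_one (hq.2.2 p) hq.2.1 (hy0 _ _).le
  have hFc := (continuousOn_tsum_primeEval ha).comp hZc hZm
  have hcl : IsClosed (K ∩ ((fun z => ∑' n, a n * primeEval z n) ∘ Z) ⁻¹' {c}) :=
    hFc.preimage_isClosed_of_isClosed hKc.isClosed isClosed_singleton
  have := ((hKc.of_isClosed_subset hcl Set.inter_subset_left).image continuous_fst).isClosed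
  convert this using 1
  ext τ
  constructor
  · rintro ⟨⟨θ, hθ, u, hu, h⟩, hτ⟩
    exact ⟨(τ, u, θ), ⟨⟨hτ, hu, hθ⟩, h⟩, rfl⟩
  · rintro ⟨⟨τ, u, θ⟩, ⟨⟨hτ, hu, hθ⟩, h⟩, rfl⟩
    exact ⟨⟨θ, hθ, u, hu, h⟩, hτ⟩

theorem differentiableOn_tsum_primeEval_exp (ha : Summable fun n => ‖a n‖)
    {θ : Nat.Primes → ℂ} (hθ : ∀ p, ‖θ p‖ = 1)
    {x : Nat.Primes → ℝ} (hx : ∀ p, 0 < x p) :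
    DifferentiableOn ℂ (fun s => ∑' n, a n * primeEval (fun p => θ p * Complex.exp (-(x p * s))) n)
      {s | 0 < s.re} := by
  refine Complex.differentiableOn_tsum_of_summable_norm ha (fun n => ?_)
    (isOpen_lt continuous_const Complex.continuous_re) fun n s hs => ?_
  · exact ((differentiable_primeEval (fun p => by fun_prop) n).const_mul _).differentiableOn
  · exact norm_mul_primeEval_le a
      (fun p => norm_mul_exp_le_one (hθ p) (le_of_lt hs) (hx p).le) n

theorem continuousAt_tsum_primeEval_exp (ha : Summable fun n => ‖a n‖)
    (hy0 : ∀ τ p, 0 < y τ p) (hyc : ∀ p, Continuous fun τ => y τ p)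
    {θ : Nat.Primes → ℂ} (hθ : ∀ p, ‖θ p‖ = 1)
    {q : ℝ × ℂ} (hq : 0 < q.2.re) :
    ContinuousAt (fun q : ℝ × ℂ =>
      ∑' n, a n * primeEval (fun p => θ p * Complex.exp (-(y q.1 p * q.2))) n) q := by
  have hopen : IsOpen {q : ℝ × ℂ | 0 < q.2.re} :=
    isOpen_lt continuous_const (Complex.continuous_re.comp continuous_snd)
  refine ContinuousOn.continuousAt (s := {q : ℝ × ℂ | 0 < q.2.re}) ?_ (hopen.mem_nhds hq)
  refine (continuousOn_tsum_primeEval ha).comp (f := fun (q : ℝ × ℂ) (p : Nat.Primes) =>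
    θ p * Complex.exp (-(y q.1 p * q.2))) ?_ fun q hq p =>
      norm_mul_exp_le_one (hθ p) (le_of_lt hq) (hy0 _ _).le
  refine Continuous.continuousOn (continuous_pi fun p => ?_)
  have := hyc p
  fun_prop

theorem tendsto_tsum_primeEval_exp (ha : Summable fun n => ‖a n‖)
    {θ : Nat.Primes → ℂ} (hθ : ∀ p, ‖θ p‖ = 1)
    {x : Nat.Primes → ℝ} (hx : ∀ p, 0 < x p) :
    Tendsto (fun σ : ℝ => ∑' n, a n * primeEval (fun p => θ p * Complex.exp (-(x p * (σ : ℂ)))) n)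
      atTop (𝓝 (∑' n, a n * primeEval (fun _ => (0 : ℂ)) n)) := by
  have h := (continuousOn_tsum_primeEval ha) (fun _ => 0) (fun p => by simp)
  refine h.tendsto.comp (tendsto_nhdsWithin_iff.2 ⟨?_, ?_⟩)
  · refine tendsto_pi_nhds.2 fun p => ?_
    rw [tendsto_zero_iff_norm_tendsto_zero]
    have : ∀ σ : ℝ, ‖θ p * Complex.exp (-(x p * (σ : ℂ)))‖ = Real.exp (-(x p * σ)) := by
      intro σ
      rw [norm_mul, hθ, one_mul, Complex.norm_exp]
      simp
    simp only [this]
    exact Real.tendsto_exp_neg_atTop_nhds_zero.comp (tendsto_id.const_mul_atTop (hx p))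
  · filter_upwards [eventually_ge_atTop 0] with σ hσ p
    exact norm_mul_exp_le_one (hθ p) (by simpa using hσ) (hx p).le

/-- A Hurwitz argument. The hypotheses exclude u = 1 and u = 0, so u = exp(-σ₀) with σ₀ > 0, and the
series becomes holomorphic in s near σ₀. A solution of G(s) = c at an interior point survives small
changes of τ by a quantitative open mapping theorem. -/
theorem value_parameters_mem_nhds (ha : Summable fun n => ‖a n‖)
    (hy0 : ∀ τ p, 0 < y τ p) (hyc : ∀ p, Continuous fun τ => y τ p)
    (htorus : ∀ θ : Nat.Primes → ℂ, (∀ p, ‖θ p‖ = 1) → ∑' n, a n * primeEval θ n ≠ c)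
    (hzero : ∑' n, a n * primeEval (fun _ => (0 : ℂ)) n ≠ c) {τ₀ : ℝ}
    (h : ∃ θ : Nat.Primes → ℂ, (∀ p, ‖θ p‖ = 1) ∧ ∃ u ∈ Set.Icc (0 : ℝ) 1,
      ∑' n, a n * primeEval (fun p => θ p * ((u ^ y τ₀ p : ℝ) : ℂ)) n = c) :
    ∀ᶠ τ in 𝓝 τ₀, ∃ θ : Nat.Primes → ℂ, (∀ p, ‖θ p‖ = 1) ∧ ∃ u ∈ Set.Icc (0 : ℝ) 1,
      ∑' n, a n * primeEval (fun p => θ p * ((u ^ y τ p : ℝ) : ℂ)) n = c := by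
  obtain ⟨θ, hθ, u, hu, hval⟩ := h
  have hu0 : 0 < u := by
    refine lt_of_le_of_ne hu.1 fun h0 => hzero ?_
    subst h0
    simpa [Real.zero_rpow (hy0 _ _).ne'] using hval
  have hu1 : u < 1 := by
    refine lt_of_le_of_ne hu.2 fun h1 => htorus θ hθ ?_
    subst h1
    simpa using hval
  set G : ℝ → ℂ → ℂ := fun τ s =>
    ∑' n, a n * primeEval (fun p => θ p * Complex.exp (-(y τ p * s))) n with hG
  set σ₀ : ℝ := -Real.log u with hσ₀
  have hσ₀pos : 0 < σ₀ := neg_pos.2 (Real.log_neg hu0 hu1)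
  have hexp : ∀ (σ x : ℝ), (((Real.exp (-σ)) ^ x : ℝ) : ℂ) = Complex.exp (-(x * (σ : ℂ))) := by
    intro σ x
    rw [← Real.exp_mul, Complex.ofReal_exp]
    congr 1
    push_cast
    ring
  have hu' : u = Real.exp (-σ₀) := by rw [hσ₀, neg_neg, Real.exp_log hu0]
  have hG0 : G τ₀ σ₀ = c := by
    rw [← hval, hG, hu']
    simp only [hexp]
  set H : Set ℂ := {s | 0 < s.re} with hH
  have hHo : IsOpen H := isOpen_lt continuous_const Complex.continuous_re
  have hHpre : IsPreconnected H := (convex_halfSpace_re_gt 0).isPreconnected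
  have hσH : (σ₀ : ℂ) ∈ H := by simpa [hH] using hσ₀pos
  have hdiff : ∀ τ, DifferentiableOn ℂ (G τ) H := fun τ =>
    differentiableOn_tsum_primeEval_exp ha hθ (hy0 τ)
  have han : AnalyticOnNhd ℂ (fun s => G τ₀ s - c) H :=
    ((hdiff τ₀).sub_const c).analyticOnNhd hHo
  -- Otherwise G equals c on the half plane, and letting s tend to +∞ gives the value c at the
  -- origin of the polydisc.
  have hne : ∀ᶠ s in 𝓝[≠] (σ₀ : ℂ), G τ₀ s - c ≠ 0 := by
    refine ((han _ hσH).eventually_eq_zero_or_eventually_ne_zero).resolve_left fun h0 => hzero ?_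
    have heq := han.eqOn_zero_of_preconnected_of_eventuallyEq_zero hHpre hσH h0
    refine tendsto_nhds_unique (tendsto_tsum_primeEval_exp ha hθ (hy0 τ₀))
      (tendsto_const_nhds.congr' ?_)
    filter_upwards [eventually_gt_atTop 0] with σ hσ
    have : G τ₀ σ - c = 0 := heq (show (σ : ℂ) ∈ H by simpa [hH] using hσ)
    exact (sub_eq_zero.1 this).symm
  obtain ⟨r, hr0, hrH, hrne⟩ : ∃ r > 0, Metric.closedBall (σ₀ : ℂ) r ⊆ H ∧
      ∀ s ∈ Metric.sphere (σ₀ : ℂ) r, G τ₀ s - c ≠ 0 := by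
    rw [eventually_nhdsWithin_iff] at hne
    obtain ⟨r, hr0, hr⟩ := Metric.nhds_basis_closedBall.eventually_iff.1
      (hne.and (hHo.mem_nhds hσH))
    refine ⟨r, hr0, fun s hs => (hr hs).2,
      fun s hs => (hr (Metric.sphere_subset_closedBall hs)).1 ?_⟩
    exact Metric.ne_of_mem_sphere hs hr0.ne'
  obtain ⟨ε, hε0, hε⟩ : ∃ ε > 0, ∀ s ∈ Metric.sphere (σ₀ : ℂ) r, ε < ‖G τ₀ s - c‖ := by
    obtain ⟨s₀, hs₀, hmin⟩ := (isCompact_sphere (σ₀ : ℂ) r).exists_isMinOn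
      (NormedSpace.sphere_nonempty.2 hr0.le)
      (((hdiff τ₀).continuousOn.mono (Metric.sphere_subset_closedBall.trans hrH)).sub
        (continuousOn_const (c := c))).norm
    have hpos : 0 < ‖G τ₀ s₀ - c‖ := norm_pos_iff.2 (hrne s₀ hs₀)
    exact ⟨‖G τ₀ s₀ - c‖ / 2, by positivity, fun s hs => (half_lt_self hpos).trans_le (hmin hs)⟩
  have hcont : ∀ s ∈ H, ContinuousAt (fun q : ℝ × ℂ => G q.1 q.2) (τ₀, s) := fun s hs =>
    continuousAt_tsum_primeEval_exp ha hy0 hyc hθ hs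
  have hcenter : ContinuousAt (fun τ : ℝ => G τ σ₀) τ₀ :=
    ContinuousAt.comp (f := fun τ : ℝ => (τ, (σ₀ : ℂ))) (hcont _ hσH) (by fun_prop)
  have hsphere : ∀ᶠ τ in 𝓝 τ₀, ∀ s ∈ Metric.sphere (σ₀ : ℂ) r, ε < ‖G τ s - G τ σ₀‖ := by
    refine (isCompact_sphere (σ₀ : ℂ) r).eventually_forall_of_forall_eventually fun s hs => ?_
    have h1 := hcont s (hrH (Metric.sphere_subset_closedBall hs))
    have h2 : ContinuousAt (fun q : ℝ × ℂ => G q.1 σ₀) (τ₀, s) :=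
      ContinuousAt.comp (g := fun τ : ℝ => G τ σ₀) (f := Prod.fst) (x := (τ₀, s)) hcenter
        continuousAt_fst
    refine ((h1.sub h2).norm).eventually (lt_mem_nhds ?_)
    have h3 := hε s hs
    rw [← hG0] at h3
    exact h3
  have hsmall : ∀ᶠ τ in 𝓝 τ₀, ‖G τ σ₀ - c‖ < ε / 2 := by
    refine ((hcenter.sub continuousAt_const).norm).eventually (gt_mem_nhds ?_)
    simpa [hG0] using hε0
  filter_upwards [hsphere, hsmall] with τ h1 h2
  have hd : DiffContOnCl ℂ (G τ) (Metric.ball (σ₀ : ℂ) r) :=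
    ((hdiff τ).mono (by rwa [closure_ball _ hr0.ne'])).diffContOnCl
  have hfreq : ∃ᶠ s in 𝓝 (σ₀ : ℂ), G τ s ≠ G τ σ₀ := by
    intro hev
    have hev : ∀ᶠ s in 𝓝 (σ₀ : ℂ), G τ s = G τ σ₀ := hev.mono fun s hs => not_not.1 hs
    have heq := ((hdiff τ).analyticOnNhd hHo).eqOn_of_preconnected_of_eventuallyEq
      (analyticOnNhd_const (v := G τ σ₀)) hHpre hσH hev
    obtain ⟨s₁, hs₁⟩ := NormedSpace.sphere_nonempty (x := (σ₀ : ℂ)).2 hr0.le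
    have h3 := h1 s₁ hs₁
    rw [heq (hrH (Metric.sphere_subset_closedBall hs₁)), sub_self, norm_zero] at h3
    exact absurd h3 (not_lt.2 hε0.le)
  have hsub := hd.ball_subset_image_closedBall hr0 (fun s hs => (h1 s hs).le) hfreq
  obtain ⟨s, hs, hsc⟩ := hsub (show c ∈ Metric.ball (G τ σ₀) (ε / 2) by
    rwa [Metric.mem_ball, dist_comm, dist_eq_norm])
  have hsre : 0 < s.re := hrH hs
  -- The solution s is complex: its imaginary part is absorbed into the torus point and its real
  -- part gives u.
  refine ⟨fun p => θ p * Complex.exp (((-(y τ p * s.im) : ℝ) : ℂ) * Complex.I), fun p => ?_,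
    Real.exp (-s.re), ⟨(Real.exp_pos _).le, Real.exp_le_one_iff.2 (by linarith)⟩, ?_⟩
  · rw [norm_mul, hθ, Complex.norm_exp_ofReal_mul_I, one_mul]
  · rw [← hsc, hG]
    dsimp only
    congr 1
    funext n
    congr 3
    funext p
    rw [hexp, mul_assoc, ← Complex.exp_add]
    congr 2
    conv_rhs => rw [← Complex.re_add_im s]
    push_cast
    ring

end ZeroTracking

/-! ### Values at bounded characters of ℕ lie in the closed range. -/

section DirichletRange

/-- The values of an absolutely convergent Dirichlet series on the closed right half plane. -/
def dirichletRange (a : ℕ+ → ℂ) : Set ℂ :=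
  (fun s => ∑' n, a n * cpowHom s n) '' {s | 0 ≤ s.re}

theorem cpowHom_add (s t : ℂ) (n : ℕ+) : cpowHom (s + t) n = cpowHom s n * cpowHom t n := by
  change ((n : ℕ) : ℂ) ^ (-(s + t)) = ((n : ℕ) : ℂ) ^ (-s) * ((n : ℕ) : ℂ) ^ (-t)
  rw [neg_add, Complex.cpow_add _ _ (by exact_mod_cast n.ne_zero)]

theorem cpowHom_prime (s : ℂ) (p : Nat.Primes) :
    cpowHom s p = Complex.exp (-(Real.log (p : ℕ) * s)) := by
  change ((p : ℕ) : ℂ) ^ (-s) = _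
  rw [Complex.cpow_def_of_ne_zero (by exact_mod_cast p.2.ne_zero), ← Complex.natCast_log, mul_neg]

theorem log_prime_pos (p : Nat.Primes) : 0 < Real.log (p : ℕ) :=
  Real.log_pos (by exact_mod_cast p.2.one_lt)

variable {a : ℕ+ → ℂ}

/-- At the points p^(-σ-it) the sum is a value of the series, and by Kronecker these points
accumulate at θ_p p^(-σ). -/
theorem tsum_primeEval_mul_cpow_mem_closure (ha : Summable fun n => ‖a n‖) {θ : Nat.Primes → ℂ}
    (hθ : ∀ p, ‖θ p‖ = 1) {σ : ℝ} (hσ : 0 ≤ σ) :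
    ∑' n, a n * primeEval (fun p => θ p * cpowHom σ p) n ∈ closure (dirichletRange a) := by
  set W : Set (Nat.Primes → ℂ) :=
    Set.range fun t : ℝ => fun p : Nat.Primes => cpowHom (t * Complex.I) p
  set m : (Nat.Primes → ℂ) → Nat.Primes → ℂ := fun z p => z p * cpowHom σ p
  have hm : ContinuousOn m primePolydisc := by
    refine Continuous.continuousOn (continuous_pi fun p => ?_)
    fun_prop
  have hmaps : Set.MapsTo m primePolydisc primePolydisc := fun z hz p => by
    rw [norm_mul]
    exact mul_le_one₀ (hz p) (norm_nonneg _) (norm_cpowHom_le_one (by simpa using hσ) _)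
  have hWsub : W ⊆ primePolydisc := by
    rintro _ ⟨t, rfl⟩ p
    exact norm_cpowHom_le_one (by simp) _
  have hc := (((continuousOn_tsum_primeEval ha).comp hm hmaps) θ
    (fun p => (hθ p).le)).mono hWsub
  refine closure_mono ?_ (hc.mem_closure_image (mem_closure_range_cpow hθ))
  rintro _ ⟨_, ⟨t, rfl⟩, rfl⟩
  refine ⟨t * Complex.I + σ, by simpa using hσ, ?_⟩
  simp only [Function.comp_apply, m, ← cpowHom_add, primeEval_eq]

theorem tsum_primeEval_zero_mem_closure (ha : Summable fun n => ‖a n‖) :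
    ∑' n, a n * primeEval (fun _ => (0 : ℂ)) n ∈ closure (dirichletRange a) := by
  refine isClosed_closure.mem_of_tendsto
    (tendsto_tsum_primeEval_exp ha (θ := fun _ => 1) (by simp) log_prime_pos) ?_
  filter_upwards [eventually_ge_atTop 0] with σ hσ
  simp only [← cpowHom_prime]
  exact tsum_primeEval_mul_cpow_mem_closure ha (θ := fun _ => 1) (by simp) hσ

/-- If c is outside the closed range, it is missed on the torus and at the origin. The parameters τ
in [0,1] for which c is attained then form a relatively clopen set containing 0, hence 1. At τ = 1
the exponents are log p, and c would be in the closed range. -/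
theorem tsum_primeEval_mem_closure_of_pos (ha : Summable fun n => ‖a n‖) {ζ : Nat.Primes → ℂ}
    (hζ : ∀ p, 0 < ‖ζ p‖ ∧ ‖ζ p‖ < 1) :
    ∑' n, a n * primeEval ζ n ∈ closure (dirichletRange a) := by
  set c := ∑' n, a n * primeEval ζ n with hc
  by_contra hcK
  -- Clamping τ to [0,1] keeps the interpolated exponents positive for every real τ.
  set κ : ℝ → ℝ := fun τ => max 0 (min 1 τ) with hκ
  have hκ0 : ∀ τ, 0 ≤ κ τ := fun τ => le_max_left _ _
  have hκ1 : ∀ τ, κ τ ≤ 1 := fun τ => max_le zero_le_one (min_le_left _ _)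
  set y : ℝ → Nat.Primes → ℝ := fun τ p =>
    (1 - κ τ) * (-Real.log ‖ζ p‖) + κ τ * Real.log (p : ℕ) with hy
  have hx : ∀ p, 0 < -Real.log ‖ζ p‖ := fun p => neg_pos.2 (Real.log_neg (hζ p).1 (hζ p).2)
  have hy0 : ∀ τ p, 0 < y τ p := by
    intro τ p
    have h1 := hx p
    have h2 := log_prime_pos p
    rcases (hκ0 τ).eq_or_lt with h | h
    · simpa [hy, ← h] using h1
    · exact add_pos_of_nonneg_of_pos (mul_nonneg (sub_nonneg.2 (hκ1 τ)) h1.le) (mul_pos h h2)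
  have hyc : ∀ p, Continuous fun τ => y τ p := by
    intro p
    simp only [hy, hκ]
    fun_prop
  have htorus : ∀ θ : Nat.Primes → ℂ, (∀ p, ‖θ p‖ = 1) → ∑' n, a n * primeEval θ n ≠ c := by
    intro θ hθ h
    refine hcK (h ▸ ?_)
    simpa [cpowHom_prime] using tsum_primeEval_mul_cpow_mem_closure ha hθ le_rfl
  have hzero : ∑' n, a n * primeEval (fun _ => (0 : ℂ)) n ≠ c := fun h =>
    hcK (h ▸ tsum_primeEval_zero_mem_closure ha)
  have hsub := (isClosed_value_parameters (c := c) ha hy0 hyc).Icc_subset_of_forall_mem_nhdsWithin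
    ?_ (fun τ hτ => mem_nhdsWithin_of_mem_nhds
      (value_parameters_mem_nhds ha hy0 hyc htorus hzero hτ.1))
  · obtain ⟨θ, hθ, u, hu, h⟩ := hsub (Set.right_mem_Icc.2 zero_le_one)
    have hy1 : ∀ p, y 1 p = Real.log (p : ℕ) := fun p => by simp [hy, hκ]
    simp only [hy1] at h
    rcases hu.1.eq_or_lt with rfl | hu0
    · refine hzero ?_
      rw [← h]
      simp only [Real.zero_rpow (log_prime_pos _).ne', Complex.ofReal_zero, mul_zero]
    · refine hcK (h ▸ ?_)
      have hσ : 0 ≤ -Real.log u := neg_nonneg.2 (Real.log_nonpos hu.1 hu.2)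
      convert tsum_primeEval_mul_cpow_mem_closure ha hθ hσ using 6 with n
      funext p
      rw [cpowHom_prime, Real.rpow_def_of_pos hu0, Complex.ofReal_exp]
      congr 1
      rw [← Complex.ofReal_mul, ← Complex.ofReal_neg, mul_neg, neg_neg, mul_comm]
  · have hy1 : ∀ p, y 0 p = -Real.log ‖ζ p‖ := fun p => by simp [hy, hκ]
    -- With u = exp(-1) and exponent -log|ζ_p|, the modulus u^y is |ζ_p|.
    refine ⟨fun p => ζ p / ‖ζ p‖, fun p => ?_, Real.exp (-1),
      ⟨(Real.exp_pos _).le, Real.exp_le_one_iff.2 (by norm_num)⟩, ?_⟩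
    · rw [norm_div, Complex.norm_real, norm_norm, div_self (hζ p).1.ne']
    · rw [hc]
      congr 1
      funext n
      congr 3
      funext p
      rw [hy1, ← Real.exp_mul, neg_mul_neg, one_mul, Real.exp_log (hζ p).1,
        div_mul_cancel₀ _ (by exact_mod_cast (hζ p).1.ne')]

/-- The polar exponents -log|ζ_p| must be finite and positive; coordinates with |ζ_p| equal to 0 or
1 are reached by continuity. -/
theorem mem_closure_punctured_ball {w : ℂ} (hw : ‖w‖ ≤ 1) :
    w ∈ closure {z : ℂ | 0 < ‖z‖ ∧ ‖z‖ < 1} := by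
  have h1 : w ∈ closure (Metric.ball (0 : ℂ) 1) := by
    rw [closure_ball _ one_ne_zero]; simpa using hw
  have h2 : Dense ({0}ᶜ : Set ℂ) := dense_compl_singleton 0
  refine closure_minimal ?_ isClosed_closure h1
  refine (h2.open_subset_closure_inter Metric.isOpen_ball).trans (closure_mono ?_)
  rintro z ⟨hz1, hz0⟩
  exact ⟨norm_pos_iff.2 hz0, by simpa using hz1⟩

/-- The values of an absolutely convergent Dirichlet series at bounded completely multiplicative
functions are limits of its values on the closed right half plane. -/
theorem tsum_mul_mem_closure_dirichletRange (ha : Summable fun n => ‖a n‖) {χ : ℕ+ →* ℂ}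
    (hχ : ∀ n, ‖χ n‖ ≤ 1) : ∑' n, a n * χ n ∈ closure (dirichletRange a) := by
  set D : Set (Nat.Primes → ℂ) := Set.univ.pi fun _ => {z : ℂ | 0 < ‖z‖ ∧ ‖z‖ < 1} with hD
  have hmem : (fun p : Nat.Primes => χ p) ∈ closure D := by
    rw [hD, closure_pi_set]
    exact fun p _ => mem_closure_punctured_ball (hχ p)
  have hsub : D ⊆ primePolydisc := fun z hz p => (hz p trivial).2.le
  have h := (((continuousOn_tsum_primeEval ha) (fun p => χ p) (fun p => hχ p)).mono
    hsub).mem_closure_image hmem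
  simp only [primeEval_eq] at h
  refine closure_minimal ?_ isClosed_closure h
  rintro _ ⟨z, hz, rfl⟩
  exact tsum_primeEval_mem_closure_of_pos ha fun p => hz p trivial

end DirichletRange

/-! ### Passage to two variables. -/

section TwoVariables

theorem summable_norm_tsum_mul {α β : Type*} {a : α × β → ℂ} (ha : Summable fun x => ‖a x‖)
    {h : β → ℂ} (hh : ∀ n, ‖h n‖ ≤ 1) : Summable fun m => ‖∑' n, a (m, n) * h n‖ := by
  refine Summable.of_nonneg_of_le (fun _ => norm_nonneg _) (fun m => ?_) ha.prod
  refine tsum_of_norm_bounded (ha.prod_factor m).hasSum fun n => ?_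
  rw [norm_mul]
  exact mul_le_of_le_one_right (norm_nonneg _) (hh n)

theorem tsum_tsum_mul_mul {α β : Type*} {a : α × β → ℂ} (ha : Summable fun x => ‖a x‖)
    {g : α → ℂ} (hg : ∀ n, ‖g n‖ ≤ 1) {h : β → ℂ} (hh : ∀ n, ‖h n‖ ≤ 1) :
    ∑' m, (∑' n, a (m, n) * h n) * g m = ∑' x, a x * (g x.1 * h x.2) := by
  have hs : Summable fun x : α × β => a x * (g x.1 * h x.2) := by
    refine Summable.of_norm_bounded ha fun x => ?_
    rw [norm_mul, norm_mul]
    exact mul_le_of_le_one_right (norm_nonneg _) (mul_le_one₀ (hg _) (norm_nonneg _) (hh _))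
  rw [hs.tsum_prod]
  refine tsum_congr fun m => ?_
  rw [← tsum_mul_right]
  exact tsum_congr fun n => by ring

/-- The values of a Dirichlet series in two variables at bounded completely multiplicative
functions are limits of its values on the square of the closed right half plane. -/
theorem tsum_mul_mem_closure_range {a : ℕ+ × ℕ+ → ℂ} (ha : Summable fun x => ‖a x‖)
    {χ : ℕ+ × ℕ+ →* ℂ} (hχ : ∀ x, ‖χ x‖ ≤ 1) :
    ∑' x, a x * χ x ∈ closure (Set.range fun s : closedRightHalfPlane × closedRightHalfPlane =>
      ∑' x : ℕ+ × ℕ+, a x * (cpowHom s.1 x.1 * cpowHom s.2 x.2)) := by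
  set χ₁ : ℕ+ →* ℂ := χ.comp (MonoidHom.inl ℕ+ ℕ+) with hχ₁
  set χ₂ : ℕ+ →* ℂ := χ.comp (MonoidHom.inr ℕ+ ℕ+) with hχ₂
  have h₁ : ∀ n, ‖χ₁ n‖ ≤ 1 := fun n => hχ _
  have h₂ : ∀ n, ‖χ₂ n‖ ≤ 1 := fun n => hχ _
  have hprod : ∀ x, χ x = χ₁ x.1 * χ₂ x.2 := by
    intro x
    simp [hχ₁, hχ₂, ← map_mul]
  have ha' : Summable fun x : ℕ+ × ℕ+ => ‖a x.swap‖ := (Equiv.prodComm ℕ+ ℕ+).summable_iff.2 ha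
  have hswap : ∀ g h : ℕ+ → ℂ, ∑' x : ℕ+ × ℕ+, a x.swap * (h x.1 * g x.2)
      = ∑' x : ℕ+ × ℕ+, a x * (g x.1 * h x.2) := by
    intro g h
    rw [← (Equiv.prodComm ℕ+ ℕ+).tsum_eq]
    exact tsum_congr fun x => by simp [mul_comm]
  simp only [hprod]
  rw [← hswap, ← tsum_tsum_mul_mul ha' h₂ h₁]
  -- With χ₁ summed out, the sum is a one-variable series at χ₂, which may be replaced by n^(-s₂).
  -- Then s₂ is frozen and χ₁ is treated likewise.
  refine closure_minimal ?_ isClosed_closure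
    (tsum_mul_mem_closure_dirichletRange (summable_norm_tsum_mul ha' h₁) h₂)
  rintro _ ⟨s₂, hs₂, rfl⟩
  have hc₂ := fun n => norm_cpowHom_le_one hs₂ n
  dsimp only
  rw [tsum_tsum_mul_mul ha' hc₂ h₁, hswap, ← tsum_tsum_mul_mul ha h₁ hc₂]
  refine closure_mono ?_
    (tsum_mul_mem_closure_dirichletRange (summable_norm_tsum_mul ha hc₂) h₁)
  rintro _ ⟨s₁, hs₁, rfl⟩
  refine ⟨(⟨s₁, hs₁⟩, ⟨s₂, hs₂⟩), ?_⟩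
  exact (tsum_tsum_mul_mul ha (fun n => norm_cpowHom_le_one hs₁ n) hc₂).symm

end TwoVariables

/-! ### Admissibility and growth along primes. -/

section Weights

/-- Apply the bound to xⁿ and take n-th roots. -/
theorem IsAdmissible.norm_le_one {ω : ℕ+ × ℕ+ → ℝ} (h : IsAdmissible ω) {χ : ℕ+ × ℕ+ →* ℂ}
    (hχ : ∀ x, ‖χ x‖ ≤ ω x) (x : ℕ+ × ℕ+) : ‖χ x‖ ≤ 1 := by
  refine ge_of_tendsto (h x.1 x.2) ?_
  filter_upwards [eventually_ne_atTop 0] with n hn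
  have h1 : ‖χ x‖ ^ n ≤ ω (x.1 ^ n, x.2 ^ n) := by
    rw [← norm_pow, ← map_pow]
    exact hχ (x ^ n)
  calc ‖χ x‖ = (‖χ x‖ ^ n) ^ (1 / (n : ℝ)) := by
        rw [one_div, Real.pow_rpow_inv_natCast (norm_nonneg _) hn]
    _ ≤ _ := Real.rpow_le_rpow (by positivity) h1 (by positivity)

theorem tendsto_rpow_one_div_nat {c : ℝ} (hc : 0 < c) :
    Tendsto (fun n : ℕ => c ^ (1 / (n : ℝ))) atTop (𝓝 1) := by
  have h := (Real.continuousAt_const_rpow (a := c) (b := 0) hc.ne').tendsto.comp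
    tendsto_one_div_atTop_nhds_zero_nat
  rwa [Real.rpow_zero] at h

theorem isAdmissible_of_isConstantWeight {ω : ℕ+ × ℕ+ → ℝ} (hω : IsWeight ω)
    (h : IsConstantWeight ω) : IsAdmissible ω := by
  obtain ⟨c, hc⟩ := h
  intro l k
  simp only [hc]
  exact tendsto_rpow_one_div_nat (by linarith [hω.one_le 1, hc 1])

/-- The elements along whose powers a weight grows subexponentially. -/
def subexponentialSubmonoid {ω : ℕ+ × ℕ+ → ℝ} (hω : IsWeight ω) : Submonoid (ℕ+ × ℕ+) where
  carrier := {x | Tendsto (fun n : ℕ => ω (x ^ n) ^ (1 / (n : ℝ))) atTop (𝓝 1)}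
  one_mem' := by
    simpa using tendsto_rpow_one_div_nat (by linarith [hω.one_le 1] : 0 < ω 1)
  mul_mem' {x y} hx hy := by
    have h := Tendsto.mul hx hy
    rw [mul_one] at h
    refine tendsto_of_tendsto_of_tendsto_of_le_of_le tendsto_const_nhds h (fun n => ?_) fun n => ?_
    · exact Real.one_le_rpow (hω.one_le _) (by positivity)
    · dsimp only
      rw [← Real.mul_rpow (by linarith [hω.one_le (x ^ n)]) (by linarith [hω.one_le (y ^ n)]),
        mul_pow]
      exact Real.rpow_le_rpow (by linarith [hω.one_le (x ^ n * y ^ n)]) (hω.mul_le _ _)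
        (by positivity)

/-- Fekete's lemma: log ω(xⁿ)/n converges to a lower bound of its terms, so one good n for each ρ
suffices. -/
theorem mem_subexponentialSubmonoid_of_forall_exists_lt {ω : ℕ+ × ℕ+ → ℝ} (hω : IsWeight ω)
    {x : ℕ+ × ℕ+} (h : ∀ ρ > 1, ∃ n : ℕ, ω (x ^ n) < ρ ^ n) :
    x ∈ subexponentialSubmonoid hω := by
  have hpos : ∀ y, 0 < ω y := fun y => by linarith [hω.one_le y]
  have hlog : ∀ y, 0 ≤ Real.log (ω y) := fun y => Real.log_nonneg (hω.one_le y)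
  have hsub : Subadditive fun n : ℕ => Real.log (ω (x ^ n)) := by
    intro m n
    dsimp only
    rw [← Real.log_mul (hpos _).ne' (hpos _).ne', pow_add]
    exact Real.log_le_log (hpos _) (hω.mul_le _ _)
  have hbdd : BddBelow (Set.range fun n : ℕ => Real.log (ω (x ^ n)) / n) := by
    refine ⟨0, ?_⟩
    rintro _ ⟨n, rfl⟩
    exact div_nonneg (hlog _) (by positivity)
  have hlim := hsub.tendsto_lim hbdd
  have h0 : 0 ≤ hsub.lim := ge_of_tendsto' hlim fun n => div_nonneg (hlog _) (by positivity)
  have hlim0 : hsub.lim = 0 := by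
    refine le_antisymm (le_of_forall_pos_le_add fun δ hδ => ?_) h0
    obtain ⟨n, hn⟩ := h (Real.exp δ) (Real.one_lt_exp_iff.2 hδ)
    have hn0 : n ≠ 0 := by
      rintro rfl
      simp only [pow_zero] at hn
      linarith [hω.one_le 1]
    have hn' : (0 : ℝ) < n := by positivity
    rw [zero_add]
    refine (hsub.lim_le_div hbdd hn0).trans ?_
    rw [div_le_iff₀ hn', Real.log_le_iff_le_exp (hpos _), mul_comm, Real.exp_nat_mul]
    exact hn.le
  rw [hlim0] at hlim
  have := (Real.continuous_exp.tendsto 0).comp hlim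
  rw [Real.exp_zero] at this
  refine this.congr fun n => ?_
  rw [Function.comp_apply, Real.rpow_def_of_pos (hpos _), mul_one_div]

/-- Elements of subexponential growth form a submonoid, and the primes in the two coordinates
generate everything. -/
theorem exists_prime_exponential_growth {ω : ℕ+ × ℕ+ → ℝ} (hω : IsWeight ω)
    (h : ¬ IsAdmissible ω) :
    ∃ p : Nat.Primes, ∃ g : ℕ+ × ℕ+, (g = ((p : ℕ+), 1) ∨ g = (1, (p : ℕ+))) ∧
      ∃ ρ > 1, ∀ n : ℕ, ρ ^ n ≤ ω (g ^ n) := by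
  by_contra! hcon
  apply h
  have hgen : ∀ p : Nat.Primes, ((p : ℕ+), (1 : ℕ+)) ∈ subexponentialSubmonoid hω ∧
      ((1 : ℕ+), (p : ℕ+)) ∈ subexponentialSubmonoid hω := fun p =>
    ⟨mem_subexponentialSubmonoid_of_forall_exists_lt hω (hcon p _ (Or.inl rfl)),
      mem_subexponentialSubmonoid_of_forall_exists_lt hω (hcon p _ (Or.inr rfl))⟩
  have hall : ∀ S : Submonoid ℕ+, (∀ p : Nat.Primes, (p : ℕ+) ∈ S) → ∀ n, n ∈ S := by
    intro S hS n
    rw [← PNat.prod_factorMultiset n, PrimeMultiset.prod]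
    refine S.multiset_prod_mem _ fun m hm => ?_
    obtain ⟨p, -, rfl⟩ := Multiset.mem_map.1 hm
    exact hS p
  intro l k
  have h1 := hall ((subexponentialSubmonoid hω).comap (MonoidHom.inl ℕ+ ℕ+))
    (fun p => (hgen p).1) l
  have h2 := hall ((subexponentialSubmonoid hω).comap (MonoidHom.inr ℕ+ ℕ+))
    (fun p => (hgen p).2) k
  have h3 := (subexponentialSubmonoid hω).mul_mem h1 h2
  simpa [subexponentialSubmonoid] using h3

end Weights

/-! ### Comparison with powers of a prime exponent. -/

section PowerWeights

/-- A power trick removes K. Since g^(n v(x)) divides xⁿ, ρ^(n v(x)) ≤ K ω(xⁿ) ≤ K ω(x)ⁿ for all n ≥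
1, which is impossible for large n if ω(x) < ρ^v(x). -/
theorem pow_le_of_exponential_growth {ω : ℕ+ × ℕ+ → ℝ} (hω : IsWeight ω) {K : ℝ}
    (hK : ∀ x y, ω x ≤ K * ω (x * y)) {g : ℕ+ × ℕ+} {ρ : ℝ} (hρ : ∀ n : ℕ, ρ ^ n ≤ ω (g ^ n))
    {v : ℕ+ × ℕ+ →* Multiplicative ℕ} (hv : ∀ x, ∃ y, x = g ^ (v x).toAdd * y) (x : ℕ+ × ℕ+) :
    ρ ^ (v x).toAdd ≤ ω x := by
  have hpos : ∀ y, 0 < ω y := fun y => by linarith [hω.one_le y]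
  have hpow : ∀ n : ℕ, ω (x ^ (n + 1)) ≤ ω x ^ (n + 1) := by
    intro n
    induction n with
    | zero => simp
    | succ n ih =>
      rw [pow_succ x, pow_succ (ω x)]
      exact (hω.mul_le _ _).trans (mul_le_mul_of_nonneg_right ih (hpos x).le)
  by_contra! hlt
  have hr : 1 < ρ ^ (v x).toAdd / ω x := (one_lt_div (hpos x)).2 hlt
  obtain ⟨n, hn⟩ := ((tendsto_pow_atTop_atTop_of_one_lt hr).eventually_gt_atTop K).and
    (eventually_gt_atTop 0) |>.exists
  obtain ⟨n, rfl⟩ := Nat.exists_eq_succ_of_ne_zero hn.2.ne'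
  have hK0 : 0 < K := by
    have := hK 1 1
    rw [mul_one] at this
    by_contra! hneg
    nlinarith [hpos 1]
  refine absurd hn.1 (not_lt.2 ?_)
  rw [div_pow, div_le_iff₀ (pow_pos (hpos x) _), ← pow_mul]
  obtain ⟨y, hy⟩ := hv (x ^ (n + 1))
  have hvx : (v (x ^ (n + 1))).toAdd = (v x).toAdd * (n + 1) := by
    rw [map_pow, toAdd_pow, smul_eq_mul, mul_comm]
  calc ρ ^ ((v x).toAdd * (n + 1)) ≤ ω (g ^ ((v x).toAdd * (n + 1))) := hρ _
    _ ≤ K * ω (g ^ ((v x).toAdd * (n + 1)) * y) := hK _ _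
    _ = K * ω (x ^ (n + 1)) := by rw [← hvx, ← hy]
    _ ≤ K * ω x ^ (n + 1) := mul_le_mul_of_nonneg_left (hpow n) hK0.le

theorem isWeight_pow {r : ℝ} (hr : 1 ≤ r) (v : ℕ+ × ℕ+ →* Multiplicative ℕ) :
    IsWeight fun x => r ^ (v x).toAdd where
  one_le x := one_le_pow₀ hr
  mul_le x y := by rw [map_mul, toAdd_mul, pow_add]

theorem isAlmostMonotone_pow {r : ℝ} (hr : 1 ≤ r) (v : ℕ+ × ℕ+ →* Multiplicative ℕ) :
    IsAlmostMonotone fun x => r ^ (v x).toAdd := by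
  refine Or.inr ⟨1, one_pos, fun m₁ n₁ m₂ n₂ ⟨m, hm⟩ ⟨n, hn⟩ => ?_⟩
  have : (m₂, n₂) = (m₁, n₁) * (m, n) := by rw [hm, hn]; rfl
  rw [one_mul, this]
  dsimp only
  rw [map_mul, toAdd_mul]
  exact pow_le_pow_right₀ hr (Nat.le_add_right _ _)

theorem not_isAdmissible_pow {r : ℝ} (hr : 1 < r) {v : ℕ+ × ℕ+ →* Multiplicative ℕ}
    {g : ℕ+ × ℕ+} (hg : (v g).toAdd = 1) : ¬ IsAdmissible fun x => r ^ (v x).toAdd := by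
  intro h
  have h1 : Tendsto (fun _ : ℕ => r) atTop (𝓝 1) := by
    refine (h g.1 g.2).congr' ?_
    filter_upwards [eventually_ne_atTop 0] with n hn
    have : (v (g.1 ^ n, g.2 ^ n)).toAdd = n := by
      have := congrArg Multiplicative.toAdd (map_pow v g n)
      rw [toAdd_pow, hg, smul_eq_mul, mul_one] at this
      exact this
    rw [this, one_div, Real.pow_rpow_inv_natCast (by linarith) hn]
  exact hr.ne' (tendsto_nhds_unique tendsto_const_nhds h1)

/-- The exponent of a prime in a positive integer, as a homomorphism. -/
noncomputable def primeExponent (p : Nat.Primes) : ℕ+ →* Multiplicative ℕ where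
  toFun n := Multiplicative.ofAdd ((n : ℕ).factorization p)
  map_one' := by simp
  map_mul' m n := by
    rw [PNat.mul_coe, Nat.factorization_mul m.ne_zero n.ne_zero]
    rfl

theorem primeExponent_self (p : Nat.Primes) : (primeExponent p (p : ℕ+)).toAdd = 1 := by
  change (p : ℕ).factorization p = 1
  exact p.2.factorization_self

theorem exists_eq_pow_primeExponent_mul (p : Nat.Primes) (n : ℕ+) :
    ∃ m, n = (p : ℕ+) ^ (primeExponent p n).toAdd * m := by
  have h : (p : ℕ+) ^ (primeExponent p n).toAdd ∣ n := by
    rw [PNat.dvd_iff, PNat.pow_coe]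
    exact Nat.ordProj_dvd (n : ℕ) p
  exact h

theorem exists_exponent_of_not_isAdmissible {ω : ℕ+ × ℕ+ → ℝ} (hω : IsWeight ω)
    (hmon : IsAlmostMonotone ω) (h : ¬ IsAdmissible ω) :
    ∃ (v : ℕ+ × ℕ+ →* Multiplicative ℕ) (g : ℕ+ × ℕ+) (ρ : ℝ), (v g).toAdd = 1 ∧ 1 < ρ ∧
      ∀ x, ρ ^ (v x).toAdd ≤ ω x := by
  obtain ⟨K, -, hK⟩ := hmon.resolve_left h
  have hK' : ∀ x y, ω x ≤ K * ω (x * y) := fun x y =>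
    hK x.1 x.2 (x.1 * y.1) (x.2 * y.2) (dvd_mul_right _ _) (dvd_mul_right _ _)
  obtain ⟨p, g, hg, ρ, hρ1, hρ⟩ := exists_prime_exponential_growth hω h
  rcases hg with rfl | rfl
  · refine ⟨(primeExponent p).comp (MonoidHom.fst ℕ+ ℕ+), ((p : ℕ+), 1), ρ,
      primeExponent_self p, hρ1, pow_le_of_exponential_growth hω hK' hρ fun x => ?_⟩
    obtain ⟨m, hm⟩ := exists_eq_pow_primeExponent_mul p x.1
    exact ⟨(m, x.2), Prod.ext hm (by simp)⟩
  · refine ⟨(primeExponent p).comp (MonoidHom.snd ℕ+ ℕ+), (1, (p : ℕ+)), ρ,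
      primeExponent_self p, hρ1, pow_le_of_exponential_growth hω hK' hρ fun x => ?_⟩
    obtain ⟨m, hm⟩ := exists_eq_pow_primeExponent_mul p x.2
    exact ⟨(x.1, m), Prod.ext (by simp) hm⟩

theorem tendsto_tsum_mul_pow_sub_one {M : Type*} {a : M → ℂ} {v : M → ℕ} {ρ : ℝ} (hρ : 1 < ρ)
    (ha : Summable fun x => ‖a x‖ * ρ ^ v x) :
    Tendsto (fun r : ℝ => ∑' x, ‖a x‖ * (r ^ v x - 1)) (𝓝[>] 1) (𝓝 0) := by
  have h : Tendsto (fun r : ℝ => ∑' x, ‖a x‖ * (r ^ v x - 1)) (𝓝[>] 1)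
      (𝓝 (∑' x, ‖a x‖ * ((1 : ℝ) ^ v x - 1))) := by
    refine tendsto_tsum_of_dominated_convergence ha (fun x => ?_) ?_
    · have : Continuous fun r : ℝ => ‖a x‖ * (r ^ v x - 1) := by fun_prop
      exact (this.tendsto 1).mono_left nhdsWithin_le_nhds
    · filter_upwards [Ioc_mem_nhdsGT hρ] with r hr x
      have h1 : 1 ≤ r ^ v x := one_le_pow₀ hr.1.le
      have h2 : r ^ v x ≤ ρ ^ v x := pow_le_pow_left₀ (by linarith [hr.1]) hr.2 _
      rw [norm_mul, norm_norm, Real.norm_of_nonneg (by linarith)]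
      exact mul_le_mul_of_nonneg_left (by linarith) (norm_nonneg _)
  simpa using h

end PowerWeights

/-! ### The choice of the new weight. -/

section Main

theorem hasSum_dirichlet_iff {a : ℕ+ × ℕ+ → ℂ} {z : ℂ}
    {s : closedRightHalfPlane × closedRightHalfPlane} :
    HasSum (fun x : ℕ+ × ℕ+ =>
        a x * ((x.1 : ℕ) : ℂ) ^ (-(s.1 : ℂ)) * ((x.2 : ℕ) : ℂ) ^ (-(s.2 : ℂ))) z ↔
      HasSum (fun x : ℕ+ × ℕ+ => a x * (cpowHom s.1 x.1 * cpowHom s.2 x.2)) z := by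
  simp only [mul_assoc]
  rfl

theorem hasAbsConvDirichletSeries_comp {ν : ℕ+ × ℕ+ → ℝ} (hν : IsWeight ν) {a : ℕ+ × ℕ+ → ℂ}
    (ha : Summable fun x => ‖a x‖ * ν x) {f : closedRightHalfPlane × closedRightHalfPlane → ℂ}
    (hf : ∀ s, HasSum (fun x : ℕ+ × ℕ+ => a x * (cpowHom s.1 x.1 * cpowHom s.2 x.2)) (f s))
    {U : Set ℂ} (hU : IsOpen U)
    (haU : ∀ χ : ℕ+ × ℕ+ →* ℂ, (∀ x, ‖χ x‖ ≤ ν x) → ∑' x, a x * χ x ∈ U) {φ : ℂ → ℂ}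
    (hφ : DifferentiableOn ℂ φ U) : HasAbsConvDirichletSeries ν (φ ∘ f) := by
  obtain ⟨b, hb, hbχ⟩ := exists_summable_comp_of_differentiableOn hν.one_le hν.mul_le ha hU haU hφ
  refine ⟨b, hb, fun s => hasSum_dirichlet_iff.2 ?_⟩
  have h := hbχ ((cpowHom s.1).coprod (cpowHom s.2)) fun x => by
    rw [MonoidHom.coprod_apply, norm_mul]
    exact (mul_le_one₀ (norm_cpowHom_le_one s.1.2 _) (norm_nonneg _)
      (norm_cpowHom_le_one s.2.2 _)).trans (hν.one_le x)
  simp only [MonoidHom.coprod_apply, (hf s).tsum_eq] at h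
  exact h

/-- The holomorphic functional calculus for absolutely convergent Dirichlet series. -/
theorem exists_weight_hasAbsConvDirichletSeries_comp {ω : ℕ+ × ℕ+ → ℝ} (hω : IsWeight ω)
    (hmon : IsAlmostMonotone ω) {f : closedRightHalfPlane × closedRightHalfPlane → ℂ}
    (hf : HasAbsConvDirichletSeries ω f) {φ : ℂ → ℂ} {U : Set ℂ} (hU : IsOpen U)
    (hfU : closure (Set.range f) ⊆ U) (hφ : DifferentiableOn ℂ φ U) :
    ∃ ξ : ℕ+ × ℕ+ → ℝ, IsWeight ξ ∧ IsAlmostMonotone ξ ∧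
      (IsConstantWeight ξ ↔ IsConstantWeight ω) ∧
      (IsAdmissible ξ ↔ IsAdmissible ω) ∧
      (∀ x, 1 ≤ ξ x ∧ ξ x ≤ ω x) ∧
      HasAbsConvDirichletSeries ξ (φ ∘ f) := by
  obtain ⟨a, ha, hfa⟩ := hf
  have hfa := fun s => hasSum_dirichlet_iff.1 (hfa s)
  have ha1 : Summable fun x => ‖a x‖ :=
    Summable.of_nonneg_of_le (fun _ => norm_nonneg _)
      (fun x => le_mul_of_one_le_right (norm_nonneg _) (hω.one_le x)) ha
  have hrange : ∀ χ : ℕ+ × ℕ+ →* ℂ, (∀ x, ‖χ x‖ ≤ 1) →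
      ∑' x, a x * χ x ∈ closure (Set.range f) := by
    intro χ hχ
    have h := tsum_mul_mem_closure_range ha1 hχ
    simp only [(hfa _).tsum_eq] at h
    exact h
  by_cases had : IsAdmissible ω
  · exact ⟨ω, hω, hmon, Iff.rfl, Iff.rfl, fun x => ⟨hω.one_le x, le_rfl⟩,
      hasAbsConvDirichletSeries_comp hω ha hfa hU
        (fun χ hχ => hfU (hrange χ (had.norm_le_one hχ))) hφ⟩
  -- Characters dominated by `ω` may now exceed 1, so a smaller weight is needed. It must remain
  -- non-admissible, which v(g) = 1 ensures for every r > 1; it is then also non-constant, as is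
  -- `ω`.
  obtain ⟨v, g, ρ, hg, hρ, hρω⟩ := exists_exponent_of_not_isAdmissible hω hmon had
  have hbdd : IsCompact (closure (Set.range f)) := by
    refine (Bornology.IsBounded.subset (Metric.isBounded_closedBall (x := (0 : ℂ))
      (r := ∑' x, ‖a x‖)) ?_).isCompact_closure
    rintro _ ⟨s, rfl⟩
    rw [mem_closedBall_zero_iff, ← (hfa s).tsum_eq]
    refine tsum_of_norm_bounded ha1.hasSum fun x => ?_
    rw [norm_mul, norm_mul]
    exact mul_le_of_le_one_right (norm_nonneg _) (mul_le_one₀ (norm_cpowHom_le_one s.1.2 _)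
      (norm_nonneg _) (norm_cpowHom_le_one s.2.2 _))
  obtain ⟨ε, hε, hεU⟩ := hbdd.exists_thickening_subset_open hU hfU
  have haρ : Summable fun x => ‖a x‖ * ρ ^ (v x).toAdd :=
    Summable.of_nonneg_of_le (fun x => by positivity)
      (fun x => mul_le_mul_of_nonneg_left (hρω x) (norm_nonneg _)) ha
  have hIoc : ∀ᶠ r in 𝓝[>] (1 : ℝ), r ∈ Set.Ioc 1 ρ := Ioc_mem_nhdsGT hρ
  obtain ⟨r, hr, hrε⟩ := (hIoc.and
    ((tendsto_tsum_mul_pow_sub_one hρ haρ).eventually (gt_mem_nhds hε))).exists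
  have hr0 : 0 < r := by linarith [hr.1]
  have hle : ∀ x, r ^ (v x).toAdd ≤ ω x := fun x =>
    (pow_le_pow_left₀ hr0.le hr.2 _).trans (hρω x)
  have har : Summable fun x => ‖a x‖ * r ^ (v x).toAdd :=
    Summable.of_nonneg_of_le (fun x => by positivity)
      (fun x => mul_le_mul_of_nonneg_left (hle x) (norm_nonneg _)) ha
  have hw := isWeight_pow hr.1.le v
  have hnad := not_isAdmissible_pow hr.1 hg
  refine ⟨fun x => r ^ (v x).toAdd, hw, isAlmostMonotone_pow hr.1.le v,
    iff_of_false (fun h => hnad (isAdmissible_of_isConstantWeight hw h))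
      (fun h => had (isAdmissible_of_isConstantWeight hω h)),
    iff_of_false hnad had, fun x => ⟨hw.one_le x, hle x⟩,
    hasAbsConvDirichletSeries_comp hw har hfa hU (fun χ hχ => hεU ?_) hφ⟩
  -- Dividing by r^v brings χ back to a character bounded by 1. The two sums differ by at most ∑
  -- |a(x)|(r^v(x) - 1), which is below ε by the choice of r.
  let χ' : ℕ+ × ℕ+ →* ℂ :=
    { toFun := fun x => χ x / (r : ℂ) ^ (v x).toAdd
      map_one' := by simp
      map_mul' := fun x y => by
        rw [map_mul, map_mul, toAdd_mul, pow_add, mul_div_mul_comm] }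
  have hχ' : ∀ x, ‖χ' x‖ ≤ 1 := by
    intro x
    change ‖χ x / (r : ℂ) ^ (v x).toAdd‖ ≤ 1
    rw [norm_div, norm_pow, Complex.norm_real, Real.norm_of_nonneg hr0.le,
      div_le_one (by positivity)]
    exact hχ x
  have hχχ' : ∀ x, χ x = χ' x * (r : ℂ) ^ (v x).toAdd := by
    intro x
    have : (r : ℂ) ≠ 0 := by exact_mod_cast hr0.ne'
    exact (div_mul_cancel₀ _ (pow_ne_zero _ this)).symm
  have hs1 : Summable fun x => a x * χ x := by
    refine Summable.of_norm_bounded har fun x => ?_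
    rw [norm_mul]
    exact mul_le_mul_of_nonneg_left (hχ x) (norm_nonneg _)
  have hs2 : Summable fun x => a x * χ' x := by
    refine Summable.of_norm_bounded ha1 fun x => ?_
    rw [norm_mul]
    exact mul_le_of_le_one_right (norm_nonneg _) (hχ' x)
  have hs3 : Summable fun x => ‖a x‖ * (r ^ (v x).toAdd - 1) := by
    simpa only [mul_sub, mul_one] using har.sub ha1
  rw [Metric.mem_thickening_iff]
  refine ⟨_, hrange χ' hχ', ?_⟩
  rw [dist_eq_norm, ← hs1.tsum_sub hs2]
  refine lt_of_le_of_lt (tsum_of_norm_bounded hs3.hasSum fun x => ?_) hrε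
  have h1 : 0 ≤ r ^ (v x).toAdd - 1 := sub_nonneg.2 (hw.one_le x)
  have h2 : a x * χ x - a x * χ' x = a x * χ' x * ((r ^ (v x).toAdd - 1 : ℝ) : ℂ) := by
    rw [hχχ']
    push_cast
    ring
  rw [h2, norm_mul, norm_mul, Complex.norm_real, Real.norm_of_nonneg h1]
  exact mul_le_mul_of_nonneg_right (mul_le_of_le_one_right (norm_nonneg _) (hχ' x)) h1

end Main

theorem theorem1 (ω : ℕ+ × ℕ+ → ℝ) (hω : IsWeight ω) (hmon : IsAlmostMonotone ω)
    (f : closedRightHalfPlane × closedRightHalfPlane → ℂ)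
    (hf : HasAbsConvDirichletSeries ω f) :
    (IsBoundedAwayFromZero f →
      ∃ ν : ℕ+ × ℕ+ → ℝ, IsWeight ν ∧ IsAlmostMonotone ν ∧
        (IsConstantWeight ν ↔ IsConstantWeight ω) ∧
        (IsAdmissible ν ↔ IsAdmissible ω) ∧
        (∀ x, 1 ≤ ν x ∧ ν x ≤ ω x) ∧
        HasAbsConvDirichletSeries ν (fun s => 1 / f s)) ∧
    (∀ (φ : ℂ → ℂ) (U : Set ℂ), IsOpen U → closure (Set.range f) ⊆ U → DifferentiableOn ℂ φ U →
      ∃ ξ : ℕ+ × ℕ+ → ℝ, IsWeight ξ ∧ IsAlmostMonotone ξ ∧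
        (IsConstantWeight ξ ↔ IsConstantWeight ω) ∧
        (IsAdmissible ξ ↔ IsAdmissible ω) ∧
        (∀ x, 1 ≤ ξ x ∧ ξ x ≤ ω x) ∧
        HasAbsConvDirichletSeries ξ (φ ∘ f)) := by
  refine ⟨fun ⟨k, hk, hkf⟩ => ?_, fun φ U hU hfU hφ =>
    exists_weight_hasAbsConvDirichletSeries_comp hω hmon hf hU hfU hφ⟩
  refine exists_weight_hasAbsConvDirichletSeries_comp (φ := fun z => 1 / z) (U := {0}ᶜ) hω hmon hf
    isOpen_compl_singleton ?_ fun z hz => ?_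
  · have hcl : closure (Set.range f) ⊆ {z | k ≤ ‖z‖} :=
      closure_minimal (by rintro _ ⟨s, rfl⟩; exact hkf s)
        (isClosed_le continuous_const continuous_norm)
    intro z hz h0
    have h1 : k ≤ ‖z‖ := hcl hz
    rw [Set.mem_singleton_iff.1 h0, norm_zero] at h1
    exact absurd hk (not_lt.2 h1)
  · have hz : z ≠ 0 := hz
    exact ((differentiableAt_const (1 : ℂ)).div differentiableAt_fun_id hz).differentiableWithinAt
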